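/- For $(x,y)\in[-\pi/2,\pi/2]^2$ put $M(x,y)=\max\{|x|,|y|\}$ and \[ h(x,y)=\left(\frac{x\sin M(x,y)}{\sqrt{x^2+y^2}},\ \frac{y\sin M(x,y)}{\sqrt{x^2+y^2}},\ \cos M(x,y)\right),\qquad h(0,0)=(0,0,1). \] Let $Z:\mathbb{R}^3\to\mathbb{R}^3\setminus\{0\}$ be the Zorich map given by $Z(x,y,z)=e^z h(x,y)$ on $[-\pi/2,\pi/2]^2\times\mathbb{R}$ and extended to $\mathbb{R}^3$ by repeated reflection in the planes $x=(k+\frac12)\pi$ and $y=(l+\frac12)\pi$ ($k,l\in\mathbb{Z}$) in the domain and in the plane $z=0$ in the image. Let $A(x,y,z)=(2rx,2ry,1-2r(z+1))$ with $r=1/(x^2+y^2+(z+1)^2)$ and $A(0,0,-1)=\infty$. Define $T:\mathbb{R}^3\to\mathbb{R}^3\cup\{\infty\}$ by $T(\mathbf{x})=A(Z(2\mathbf{x}))$ and, for $\lambda>0$, put $T_\lambda=\lambda T$ (with $\lambda\infty=\infty$). The iterate $T_\lambda^k$ is undefined at the points whose orbit reaches $\infty$ in fewer than $k$ steps. Let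 $O^-(\infty)=\bigcup_{k\ge1}T_\lambda^{-k}(\infty)$, let \[ I(T_\lambda)=\{\mathbf{x}\in\mathbb{R}^3\setminus O^-(\infty): T_\lambda^k(\mathbf{x})\to\infty \text{ as } k\to\infty\} \] be the escaping set, and call $\mathbf{x}\in\mathbb{R}^3$ a periodic point of $T_\lambda$ if $T_\lambda^k(\mathbf{x})=\mathbf{x}$ for some $k\ge1$. Theorem. For every $\lambda>0$, the closure in $\mathbb{R}^3$ of the set of periodic points of $T_\lambda$ contains $I(T_\lambda)$. -/

import Mathlib

noncomputable section

namespace QRTangent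

/-- Euclidean three-space. -/
abbrev R3 : Type := EuclideanSpace ℝ (Fin 3)

/-- `M(x, y) = max {|x|, |y|}`. -/
def M (x y : ℝ) : ℝ := max |x| |y|

/-- The bi-Lipschitz parametrization of the closed upper unit hemisphere by the square
`[-π/2, π/2]²`, `h(x, y) = (x sin M / √(x² + y²), y sin M / √(x² + y²), cos M)`.
At the origin the first two quotients are `0 / 0 = 0`, which is the continuous extension. -/
def h (x y : ℝ) : R3 :=
  !₂[x * Real.sin (M x y) / √(x ^ 2 + y ^ 2),
     y * Real.sin (M x y) / √(x ^ 2 + y ^ 2),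
     Real.cos (M x y)]

/-- The index `k` of an interval `[(k - 1/2)π, (k + 1/2)π]` containing `t`; its parity is that of
the number of reflections `t ↦ (2j + 1)π - t` needed to move `t` into `[-π/2, π/2]`. -/
def cell (t : ℝ) : ℤ := round (t / Real.pi)

/-- The point of `[-π/2, π/2]` obtained from `t` by repeated reflections in the points
`(j + 1/2)π`, `j ∈ ℤ`. -/
def fold (t : ℝ) : ℝ := (-1 : ℝ) ^ cell t * (t - cell t * Real.pi)

/-- The Zorich map: `Z(x, y, z) = e^z h(x, y)` on `[-π/2, π/2]² × ℝ`, extended to `ℝ³` by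
repeated reflection in the planes `x = (k + 1/2)π` and `y = (l + 1/2)π` in the domain and in the
plane `z = 0` in the image. (Where the choice of `cell` is ambiguous, the third coordinate
of `h` vanishes.) -/
def Z (p : R3) : R3 :=
  let w : R3 := h (fold (p 0)) (fold (p 1))
  Real.exp (p 2) • !₂[w 0, w 1, (-1 : ℝ) ^ (cell (p 0) + cell (p 1)) * w 2]

/-- The Möbius map `A(x, y, z) = (2rx, 2ry, 1 - 2r(z + 1))`, where
`r = 1 / (x² + y² + (z + 1)²)`, with `A(0, 0, -1) = ∞`. -/
def A (p : R3) : OnePoint R3 :=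
  let d : ℝ := p 0 ^ 2 + p 1 ^ 2 + (p 2 + 1) ^ 2
  if d = 0 then OnePoint.infty
  else ((!₂[2 * (1 / d) * p 0, 2 * (1 / d) * p 1, 1 - 2 * (1 / d) * (p 2 + 1)] : R3) : OnePoint R3)

/-- The generalized tangent map `T(x) = A(Z(2x))`. -/
def T (p : R3) : OnePoint R3 := A (Z ((2 : ℝ) • p))

/-- `T_lam(x) = lam T(x)`, with `lam ∞ = ∞`. -/
def scaledT (lam : ℝ) (p : R3) : OnePoint R3 := OnePoint.map (fun v : R3 => lam • v) (T p)

/-- A map `f : ℝ³ → ℝ³ ∪ {∞}` as a self-map of `ℝ³ ∪ {∞}` that keeps `∞` at `∞`. It serves only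
to iterate `f`: the value `∞` for the `k`-th iterate at `x` says that the orbit of `x` meets a
pole, i.e. lands at `∞` at some step `1 ≤ j ≤ k` (so that `f ^ k` is undefined at `x` if
`j < k`). -/
def extend (f : R3 → OnePoint R3) (p : OnePoint R3) : OnePoint R3 :=
  p.elim OnePoint.infty f

/-- The `k`-th iterate of `f`, with the convention of `extend`. -/
def iter (f : R3 → OnePoint R3) (k : ℕ) (x : R3) : OnePoint R3 := (extend f)^[k] (x : OnePoint R3)

/-- The backward orbit of infinity, `⋃_{k ≥ 1} f^{-k}(∞)`. -/
def backwardOrbitInfty (f : R3 → OnePoint R3) : Set R3 :=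
  {x | ∃ k : ℕ, 1 ≤ k ∧ iter f k x = OnePoint.infty}

/-- The escaping set: the points whose iterates tend to, but never land at, infinity. -/
def escapingSet (f : R3 → OnePoint R3) : Set R3 :=
  {x | x ∉ backwardOrbitInfty f ∧
    Filter.Tendsto (fun k : ℕ => iter f k x) Filter.atTop (nhds OnePoint.infty)}

/-- The set of periodic points of `f` in `ℝ³`: `f ^ k (x) = x` for some `k ≥ 1`. -/
def periodicPoints (f : R3 → OnePoint R3) : Set R3 :=
  {x | ∃ k : ℕ, 1 ≤ k ∧ iter f k x = (x : OnePoint R3)}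

end QRTangent

end

noncomputable section

namespace QRTangent

open Filter Topology Metric
open scoped ComplexConjugate NNReal

/-! Escaping points lie in the plane z = 0. If the image of a point is very large, the point lies
within height 1 of the plane and its height at least doubles in absolute value
(`exists_third_expanding`). Along an escaping orbit the height must therefore vanish eventually, and
then it vanishes from the start, because only points of the plane are mapped into the plane
(`third_eq_zero_of_image`).

On the plane, h parametrizes a hemisphere of the unit sphere and A is stereographic projection. A
checkerboard of squares of side π/2 results: even squares are mapped onto the closed disk of radius
`lam`, odd squares onto the closure of its exterior together with ∞, with the pole at the centre.
Every inverse branch is Lipschitz, and near ∞ the odd branches contract strongly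
(`dist_branch_le_of_odd`). Far out, an escaping orbit uses odd branches only, so the images of a
neighbourhood U of its starting point contain growing disks, then a pole, and then a full
neighbourhood of ∞ (`exists_exterior_subset_iterate_img`).

Hence some iterated image of U contains a pole that avoids the forward orbits of the finitely many
corner images. Corners are the only obstruction to Lipschitz local inverses, so the pole pulls back
to a point y of U along a Lipschitz section g (`exists_hasSection`). Starting near y, take a
preimage, move it far away by the period π, apply the odd branch to land near the pole, and return
to y by g. The far translation makes this composite a contraction of a small disk about y, and its
fixed point is periodic (`exists_periodic_of_hasSection`). -/

/-! ### The map on the plane `z = 0` -/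

/-- The plane `z = 0`, parametrized by the complex numbers. -/
def emb (z : ℂ) : R3 := !₂[z.re, z.im, 0]

/-- The reflection group acting on cells. -/
def reflect (k l : ℤ) (z : ℂ) : ℂ := ⟨(-1) ^ k * z.re, (-1) ^ l * z.im⟩

/-- The centre of a cell of the plane. -/
def centre (k l : ℤ) : ℂ := ⟨k * (Real.pi / 2), l * (Real.pi / 2)⟩

/-- The inverse of `u ↦ tan (M u) • u / |u|`, a homeomorphism from the closed unit disk onto the
square `[-π/4, π/4]²`. -/
def chart (z : ℂ) : ℂ := (Real.arctan ‖z‖ / M z.re z.im : ℝ) * z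

lemma norm_le_two_M (z : ℂ) : ‖z‖ ≤ 2 * M z.re z.im := by
  have h1 : |z.re| ≤ M z.re z.im := le_max_left _ _
  have h2 : |z.im| ≤ M z.re z.im := le_max_right _ _
  linarith [Complex.norm_le_abs_re_add_abs_im z]

lemma M_pos {z : ℂ} (hz : z ≠ 0) : 0 < M z.re z.im := by
  have := norm_pos_iff.mpr hz
  linarith [norm_le_two_M z]

lemma abs_M_sub_M_le (z w : ℂ) : |M z.re z.im - M w.re w.im| ≤ ‖z - w‖ := by
  refine (abs_max_sub_max_le_max _ _ _ _).trans (max_le ?_ ?_)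
  · exact (abs_abs_sub_abs_le _ _).trans (by simpa using Complex.abs_re_le_norm (z - w))
  · exact (abs_abs_sub_abs_le _ _).trans (by simpa using Complex.abs_im_le_norm (z - w))

lemma M_mul_of_nonneg {c : ℝ} (hc : 0 ≤ c) (x y : ℝ) : M (c * x) (c * y) = c * M x y := by
  simp only [M, abs_mul, abs_of_nonneg hc]
  exact (mul_max_of_nonneg _ _ hc).symm

lemma M_of_abs_eq {x y x' y' : ℝ} (hx : |x| = |x'|) (hy : |y| = |y'|) : M x y = M x' y' := by
  rw [M, M, hx, hy]

lemma abs_neg_one_zpow_mul (k : ℤ) (x : ℝ) : |(-1 : ℝ) ^ k * x| = |x| := by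
  rw [abs_mul, abs_zpow]; simp

lemma neg_one_zpow_mul_self (k : ℤ) : (-1 : ℝ) ^ k * (-1 : ℝ) ^ k = 1 := by
  rcases Int.even_or_odd k with h | h
  · simp [h.neg_one_zpow]
  · simp [h.neg_one_zpow]

lemma reflect_reflect (k l : ℤ) (z : ℂ) : reflect k l (reflect k l z) = z := by
  apply Complex.ext
  · simp only [reflect]; rw [← mul_assoc, neg_one_zpow_mul_self, one_mul]
  · simp only [reflect]; rw [← mul_assoc, neg_one_zpow_mul_self, one_mul]

lemma norm_reflect (k l : ℤ) (z : ℂ) : ‖reflect k l z‖ = ‖z‖ := by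
  have h1 := neg_one_zpow_mul_self k
  have h2 := neg_one_zpow_mul_self l
  rw [Complex.norm_eq_sqrt_sq_add_sq, Complex.norm_eq_sqrt_sq_add_sq]
  simp only [reflect]
  congr 1
  linear_combination z.re ^ 2 * h1 + z.im ^ 2 * h2

lemma reflect_sub (k l : ℤ) (z w : ℂ) : reflect k l z - reflect k l w = reflect k l (z - w) := by
  apply Complex.ext <;> simp only [reflect, Complex.sub_re, Complex.sub_im] <;> ring

lemma dist_reflect (k l : ℤ) (z w : ℂ) : dist (reflect k l z) (reflect k l w) = dist z w := by
  rw [dist_eq_norm, dist_eq_norm, reflect_sub, norm_reflect]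

lemma M_reflect (k l : ℤ) (z : ℂ) : M (reflect k l z).re (reflect k l z).im = M z.re z.im :=
  M_of_abs_eq (abs_neg_one_zpow_mul _ _) (abs_neg_one_zpow_mul _ _)

lemma chart_zero : chart 0 = 0 := by simp [chart]

lemma chart_re (z : ℂ) : (chart z).re = Real.arctan ‖z‖ / M z.re z.im * z.re := by
  simp only [chart, Complex.re_ofReal_mul]

lemma chart_im (z : ℂ) : (chart z).im = Real.arctan ‖z‖ / M z.re z.im * z.im := by
  simp only [chart, Complex.im_ofReal_mul]

lemma arctan_norm_nonneg (z : ℂ) : 0 ≤ Real.arctan ‖z‖ := Real.arctan_nonneg.mpr (norm_nonneg z)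

lemma M_chart (z : ℂ) : M (chart z).re (chart z).im = Real.arctan ‖z‖ := by
  rcases eq_or_ne z 0 with rfl | hz
  · simp [chart_zero, M]
  · have hM := M_pos hz
    rw [chart_re, chart_im, M_mul_of_nonneg (div_nonneg (arctan_norm_nonneg z) hM.le)]
    field_simp

lemma arctan_le_self {x : ℝ} (hx : 0 ≤ x) : Real.arctan x ≤ x := by
  have h1 : Real.arctan x < Real.pi / 2 := Real.arctan_lt_pi_div_two x
  have := Real.le_tan (Real.arctan_nonneg.mpr hx) h1
  rwa [Real.tan_arctan] at this

lemma abs_arctan_sub_le (x y : ℝ) : |Real.arctan x - Real.arctan y| ≤ |x - y| := by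
  have := (lipschitzWith_of_nnnorm_deriv_le (C := 1) (f := Real.arctan)
    Real.differentiable_arctan (fun x => by
      rw [← NNReal.coe_le_coe, coe_nnnorm, Real.deriv_arctan, Real.norm_eq_abs, abs_of_nonneg
        (by positivity), NNReal.coe_one]
      rw [div_le_one (by positivity)]
      nlinarith [sq_nonneg x])).dist_le_mul x y
  simpa [Real.dist_eq] using this

lemma norm_chart_le (z : ℂ) : ‖chart z‖ ≤ 2 * ‖z‖ := by
  have := norm_le_two_M (chart z)
  rw [M_chart] at this
  linarith [arctan_le_self (norm_nonneg z)]

/-- Changing z, the factor 1/M and the arctangent one at a time costs 2, 4 and 2. The quotients stay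
bounded because the norm is at most 2M, and both M and arctan are 1-Lipschitz. -/
lemma dist_chart_le (z w : ℂ) : dist (chart z) (chart w) ≤ 8 * dist z w := by
  rw [dist_eq_norm, dist_eq_norm]
  rcases eq_or_ne z 0 with rfl | hz
  · rw [chart_zero, zero_sub, zero_sub, norm_neg, norm_neg]
    linarith [norm_chart_le w, norm_nonneg w]
  rcases eq_or_ne w 0 with rfl | hw
  · rw [chart_zero, sub_zero, sub_zero]
    linarith [norm_chart_le z, norm_nonneg z]
  have hM := M_pos hz
  have hN := M_pos hw
  set m := M z.re z.im
  set n := M w.re w.im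
  have e : chart z - chart w = (Real.arctan ‖z‖ / m : ℝ) * (z - w)
      + (Real.arctan ‖z‖ * ((n - m) / (m * n)) : ℝ) * w
      + ((Real.arctan ‖z‖ - Real.arctan ‖w‖) / n : ℝ) * w := by
    have : (m : ℂ) ≠ 0 := by exact_mod_cast hM.ne'
    have : (n : ℂ) ≠ 0 := by exact_mod_cast hN.ne'
    change ((Real.arctan ‖z‖ / m : ℝ) : ℂ) * z - ((Real.arctan ‖w‖ / n : ℝ) : ℂ) * w = _
    push_cast [-Complex.ofReal_arctan]
    field_simp
    ring
  have hz2 : ‖z‖ ≤ 2 * m := norm_le_two_M z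
  have hw2 : ‖w‖ ≤ 2 * n := norm_le_two_M w
  have ha := arctan_le_self (norm_nonneg z)
  have ha0 := arctan_norm_nonneg z
  have hmn : |n - m| ≤ ‖z - w‖ := by rw [abs_sub_comm]; exact abs_M_sub_M_le z w
  have har : |Real.arctan ‖z‖ - Real.arctan ‖w‖| ≤ ‖z - w‖ :=
    (abs_arctan_sub_le _ _).trans (abs_norm_sub_norm_le z w)
  have t1 : ‖((Real.arctan ‖z‖ / m : ℝ) : ℂ) * (z - w)‖ ≤ 2 * ‖z - w‖ := by
    rw [norm_mul, Complex.norm_real, Real.norm_of_nonneg (by positivity)]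
    gcongr
    rw [div_le_iff₀ hM]; linarith
  have t2 : ‖((Real.arctan ‖z‖ * ((n - m) / (m * n)) : ℝ) : ℂ) * w‖ ≤ 4 * ‖z - w‖ := by
    rw [norm_mul, Complex.norm_real, norm_mul, norm_div, Real.norm_of_nonneg ha0,
      Real.norm_eq_abs, Real.norm_of_nonneg (by positivity : 0 ≤ m * n)]
    calc Real.arctan ‖z‖ * (|n - m| / (m * n)) * ‖w‖
        ≤ (2 * m) * (‖z - w‖ / (m * n)) * (2 * n) := by
          gcongr
          linarith
      _ = 4 * ‖z - w‖ := by field_simp; ring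
  have t3 : ‖(((Real.arctan ‖z‖ - Real.arctan ‖w‖) / n : ℝ) : ℂ) * w‖ ≤ 2 * ‖z - w‖ := by
    rw [norm_mul, Complex.norm_real, norm_div, Real.norm_eq_abs, Real.norm_of_nonneg hN.le]
    calc |Real.arctan ‖z‖ - Real.arctan ‖w‖| / n * ‖w‖ ≤ ‖z - w‖ / n * (2 * n) := by gcongr
      _ = 2 * ‖z - w‖ := by field_simp
  rw [e]
  refine (norm_add₃_le).trans ?_
  linarith

lemma exists_chart_eq {u : ℂ} (hu : M u.re u.im ≤ Real.pi / 4) : ∃ z : ℂ, ‖z‖ ≤ 1 ∧ chart z = u := by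
  rcases eq_or_ne u 0 with rfl | hne
  · exact ⟨0, by simp, chart_zero⟩
  have hM := M_pos hne
  have hn := norm_pos_iff.mpr hne
  set m := M u.re u.im with hm
  have hm2 : m < Real.pi / 2 := by linarith [Real.pi_pos]
  have ht : 0 < Real.tan m := Real.tan_pos_of_pos_of_lt_pi_div_two hM hm2
  have hc : 0 < Real.tan m / ‖u‖ := by positivity
  have hnorm : ‖((Real.tan m / ‖u‖ : ℝ) : ℂ) * u‖ = Real.tan m := by
    rw [norm_mul, Complex.norm_real, Real.norm_of_nonneg hc.le]
    field_simp
  refine ⟨(Real.tan m / ‖u‖ : ℝ) * u, ?_, ?_⟩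
  · rw [hnorm, ← Real.tan_pi_div_four]
    exact Real.strictMonoOn_tan.monotoneOn ⟨by linarith, hm2⟩
      ⟨by linarith [Real.pi_pos], by linarith [Real.pi_pos]⟩ hu
  · rw [chart, hnorm, Real.arctan_tan (by linarith [Real.pi_pos]) hm2, Complex.re_ofReal_mul,
      Complex.im_ofReal_mul, M_mul_of_nonneg hc.le, ← hm]
    have : (m : ℂ) ≠ 0 := by exact_mod_cast hM.ne'
    have : (‖u‖ : ℂ) ≠ 0 := by exact_mod_cast hn.ne'
    have : (Real.tan m : ℂ) ≠ 0 := by exact_mod_cast ht.ne'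
    push_cast [-Complex.ofReal_tan]
    field_simp

/-- The reason for the form of `chart`: by the double-angle formulas for arctan ‖z‖, h(2 · chart z)
is the inverse stereographic projection of z. -/
lemma h_two_mul_chart (z : ℂ) : h (2 * (chart z).re) (2 * (chart z).im) =
    !₂[2 * z.re / (1 + ‖z‖ ^ 2), 2 * z.im / (1 + ‖z‖ ^ 2), (1 - ‖z‖ ^ 2) / (1 + ‖z‖ ^ 2)] := by
  have hM2 : M (2 * (chart z).re) (2 * (chart z).im) = 2 * Real.arctan ‖z‖ := by
    rw [M_mul_of_nonneg (by norm_num), M_chart]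
  have hcos : Real.cos (Real.arctan ‖z‖) ^ 2 = 1 / (1 + ‖z‖ ^ 2) := Real.cos_sq_arctan _
  have hcpos : 0 < Real.cos (Real.arctan ‖z‖) := Real.cos_arctan_pos _
  have hsin : Real.sin (Real.arctan ‖z‖) = ‖z‖ * Real.cos (Real.arctan ‖z‖) := by
    rw [← Real.tan_mul_cos hcpos.ne', Real.tan_arctan]
  have hs2 : Real.sin (2 * Real.arctan ‖z‖) = 2 * ‖z‖ / (1 + ‖z‖ ^ 2) := by
    rw [Real.sin_two_mul, hsin]
    linear_combination 2 * ‖z‖ * hcos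
  have hc2 : Real.cos (2 * Real.arctan ‖z‖) = (1 - ‖z‖ ^ 2) / (1 + ‖z‖ ^ 2) := by
    rw [Real.cos_two_mul, hcos]; field_simp; ring
  rcases eq_or_ne z 0 with rfl | hz
  · simp [h, chart_zero, M]
  have hM := M_pos hz
  have hn := norm_pos_iff.mpr hz
  have ha : 0 < Real.arctan ‖z‖ := Real.arctan_pos.mpr hn
  set c := Real.arctan ‖z‖ / M z.re z.im with hc
  have hcp : 0 < c := by positivity
  have hsq : √((2 * (chart z).re) ^ 2 + (2 * (chart z).im) ^ 2) = 2 * c * ‖z‖ := by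
    rw [chart_re, chart_im, ← hc, Real.sqrt_eq_iff_mul_self_eq_of_pos (by positivity)]
    have hs : ‖z‖ ^ 2 = z.re ^ 2 + z.im ^ 2 := by rw [Complex.sq_norm, Complex.normSq_apply]; ring
    linear_combination 4 * c ^ 2 * hs
  simp only [h, hM2, hsq, hs2, hc2]
  rw [chart_re, chart_im, ← hc]
  congr 2
  · field_simp
  · congr 1
    field_simp

/-! ### Explicit formulas for Z and T on each cell. -/

lemma cell_eq_or {t : ℝ} {k : ℤ} (ht : |t - k * Real.pi| ≤ Real.pi / 2) :
    cell t = k ∨ (cell t = k + 1 ∧ t = (k + 1 / 2) * Real.pi) ∨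
      (cell t = k - 1 ∧ t = (k - 1 / 2) * Real.pi) := by
  have hpi := Real.pi_pos
  set s := t / Real.pi with hs
  have hts : t = s * Real.pi := by rw [hs]; field_simp
  have h1 : |s - cell t| ≤ 1 / 2 := abs_sub_round _
  have h2 : |s - k| ≤ 1 / 2 := by
    rw [hts, ← sub_mul, abs_mul, abs_of_pos hpi] at ht
    nlinarith
  rw [abs_le] at h1 h2
  have h3 : cell t ≤ k + 1 := by
    have : (cell t : ℝ) ≤ k + 1 := by linarith
    exact_mod_cast this
  have h4 : k - 1 ≤ cell t := by
    have : (k : ℝ) - 1 ≤ cell t := by linarith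
    exact_mod_cast this
  rcases (by omega : cell t = k ∨ cell t = k + 1 ∨ cell t = k - 1) with h | h | h
  · exact Or.inl h
  · right; left
    refine ⟨h, ?_⟩
    rw [h] at h1; push_cast at h1
    rw [hts, show s = k + 1 / 2 by linarith]
  · right; right
    refine ⟨h, ?_⟩
    rw [h] at h1; push_cast at h1
    rw [hts, show s = k - 1 / 2 by linarith]

lemma fold_eq {t : ℝ} {k : ℤ} (ht : |t - k * Real.pi| ≤ Real.pi / 2) :
    fold t = (-1) ^ k * (t - k * Real.pi) := by
  rcases cell_eq_or ht with h | ⟨h, h'⟩ | ⟨h, h'⟩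
  · rw [fold, h]
  · rw [fold, h, h', zpow_add₀ (by norm_num)]; push_cast; simp; ring
  · rw [fold, h, h', zpow_sub₀ (by norm_num)]; push_cast; simp; ring

/-- The rounded index can differ from the chosen one only on an edge, and there M = π/2, so the
cosine is zero and the sign is immaterial. -/
lemma neg_one_zpow_cell_mul_cos {s t : ℝ} {k l : ℤ} (hs : |s - k * Real.pi| ≤ Real.pi / 2)
    (ht : |t - l * Real.pi| ≤ Real.pi / 2) :
    (-1 : ℝ) ^ (cell s + cell t) * Real.cos (M (fold s) (fold t)) =
      (-1) ^ (k + l) * Real.cos (M (fold s) (fold t)) := by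
  have e1 : |fold s| = |s - k * Real.pi| := by rw [fold_eq hs, abs_neg_one_zpow_mul]
  have e2 : |fold t| = |t - l * Real.pi| := by rw [fold_eq ht, abs_neg_one_zpow_mul]
  have hpi := Real.pi_pos
  by_cases hb : |s - k * Real.pi| = Real.pi / 2 ∨ |t - l * Real.pi| = Real.pi / 2
  · have : M (fold s) (fold t) = Real.pi / 2 := by
      rw [M, e1, e2]
      rcases hb with hb | hb
      · rw [hb]; exact max_eq_left ht
      · rw [hb]; exact max_eq_right hs
    simp [this]
  · push Not at hb
    have c1 : cell s = k := by
      rcases cell_eq_or hs with h | ⟨-, h⟩ | ⟨-, h⟩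
      · exact h
      · exact absurd (by rw [h, abs_of_pos] <;> linarith) hb.1
      · exact absurd (by rw [h, abs_of_neg] <;> linarith) hb.1
    have c2 : cell t = l := by
      rcases cell_eq_or ht with h | ⟨-, h⟩ | ⟨-, h⟩
      · exact h
      · exact absurd (by rw [h, abs_of_pos] <;> linarith) hb.2
      · exact absurd (by rw [h, abs_of_neg] <;> linarith) hb.2
    rw [c1, c2]

lemma M_chart_le {z : ℂ} (hz : ‖z‖ ≤ 1) : M (chart z).re (chart z).im ≤ Real.pi / 4 := by
  rw [M_chart, ← Real.arctan_one]
  exact Real.arctan_strictMono.monotone hz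

lemma Z_emb {k l : ℤ} {z : ℂ} (hz : ‖z‖ ≤ 1) :
    Z ((2 : ℝ) • emb (centre k l + reflect k l (chart z))) =
      !₂[2 * z.re / (1 + ‖z‖ ^ 2), 2 * z.im / (1 + ‖z‖ ^ 2),
        (-1) ^ (k + l) * ((1 - ‖z‖ ^ 2) / (1 + ‖z‖ ^ 2))] := by
  have hM := M_chart_le hz
  set u := chart z with hu
  have hre : |u.re| ≤ Real.pi / 4 := (le_max_left _ _).trans hM
  have him : |u.im| ≤ Real.pi / 4 := (le_max_right _ _).trans hM
  have p0 : ((2 : ℝ) • emb (centre k l + reflect k l u)) 0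
      = k * Real.pi + (-1) ^ k * (2 * u.re) := by
    simp [emb, centre, reflect]; ring
  have p1 : ((2 : ℝ) • emb (centre k l + reflect k l u)) 1
      = l * Real.pi + (-1) ^ l * (2 * u.im) := by
    simp [emb, centre, reflect]; ring
  have p2 : ((2 : ℝ) • emb (centre k l + reflect k l u)) 2 = 0 := by
    simp [emb]
  have b0 : |(k * Real.pi + (-1) ^ k * (2 * u.re)) - k * Real.pi| ≤ Real.pi / 2 := by
    rw [add_sub_cancel_left, abs_neg_one_zpow_mul, abs_mul, abs_two]; linarith
  have b1 : |(l * Real.pi + (-1) ^ l * (2 * u.im)) - l * Real.pi| ≤ Real.pi / 2 := by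
    rw [add_sub_cancel_left, abs_neg_one_zpow_mul, abs_mul, abs_two]; linarith
  have f0 : fold (k * Real.pi + (-1) ^ k * (2 * u.re)) = 2 * u.re := by
    rw [fold_eq b0, add_sub_cancel_left, ← mul_assoc, neg_one_zpow_mul_self, one_mul]
  have f1 : fold (l * Real.pi + (-1) ^ l * (2 * u.im)) = 2 * u.im := by
    rw [fold_eq b1, add_sub_cancel_left, ← mul_assoc, neg_one_zpow_mul_self, one_mul]
  have hsgn := neg_one_zpow_cell_mul_cos b0 b1
  rw [f0, f1] at hsgn
  have hh := h_two_mul_chart z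
  rw [← hu] at hh
  have h2 : Real.cos (M (2 * u.re) (2 * u.im)) = (1 - ‖z‖ ^ 2) / (1 + ‖z‖ ^ 2) := by
    have := congrArg (fun v : R3 => v 2) hh
    simpa [h] using this
  rw [h2] at hsgn
  simp only [Z, p0, p1, p2, f0, f1, hh, Real.exp_zero, one_smul]
  congr 3
  simpa using hsgn

lemma A_eq_coe {a b c d : ℝ} (h : a ^ 2 + b ^ 2 + (c + 1) ^ 2 = d) (hd : d ≠ 0) :
    A !₂[a, b, c] =
      ((!₂[2 * (1 / d) * a, 2 * (1 / d) * b, 1 - 2 * (1 / d) * (c + 1)] : R3) : OnePoint R3) := by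
  subst h
  exact if_neg hd

lemma T_emb_even {k l : ℤ} (hkl : Even (k + l)) {z : ℂ} (hz : ‖z‖ ≤ 1) :
    T (emb (centre k l + reflect k l (chart z))) = (emb z : OnePoint R3) := by
  have hs : ‖z‖ ^ 2 = z.re ^ 2 + z.im ^ 2 := by rw [Complex.sq_norm, Complex.normSq_apply]; ring
  have hp : 0 < 1 + ‖z‖ ^ 2 := by positivity
  rw [T, Z_emb hz, hkl.neg_one_zpow, one_mul]
  have hd : (2 * z.re / (1 + ‖z‖ ^ 2)) ^ 2 + (2 * z.im / (1 + ‖z‖ ^ 2)) ^ 2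
      + ((1 - ‖z‖ ^ 2) / (1 + ‖z‖ ^ 2) + 1) ^ 2 = 4 / (1 + ‖z‖ ^ 2) := by
    field_simp
    linear_combination (-4 : ℝ) * hs
  have e0 : 2 * (1 / (4 / (1 + ‖z‖ ^ 2))) * (2 * z.re / (1 + ‖z‖ ^ 2)) = z.re := by
    field_simp; norm_num
  have e1 : 2 * (1 / (4 / (1 + ‖z‖ ^ 2))) * (2 * z.im / (1 + ‖z‖ ^ 2)) = z.im := by
    field_simp; norm_num
  have e2 : 1 - 2 * (1 / (4 / (1 + ‖z‖ ^ 2))) * ((1 - ‖z‖ ^ 2) / (1 + ‖z‖ ^ 2) + 1) = 0 := by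
    field_simp; ring
  rw [A_eq_coe hd (by positivity), e0, e1, e2]
  rfl

/-- On an odd cell the image of Z is reflected in z = 0. Under stereographic projection this
reflection becomes inversion in the unit circle. -/
lemma T_emb_odd {k l : ℤ} (hkl : Odd (k + l)) {z : ℂ} (hz : ‖z‖ ≤ 1) (h0 : z ≠ 0) :
    T (emb (centre k l + reflect k l (chart z))) = (emb (conj z)⁻¹ : OnePoint R3) := by
  have hs : ‖z‖ ^ 2 = z.re ^ 2 + z.im ^ 2 := by rw [Complex.sq_norm, Complex.normSq_apply]; ring
  have hp : 0 < 1 + ‖z‖ ^ 2 := by positivity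
  have hn := norm_pos_iff.mpr h0
  rw [T, Z_emb hz, hkl.neg_one_zpow]
  have hd : (2 * z.re / (1 + ‖z‖ ^ 2)) ^ 2 + (2 * z.im / (1 + ‖z‖ ^ 2)) ^ 2
      + (-1 * ((1 - ‖z‖ ^ 2) / (1 + ‖z‖ ^ 2)) + 1) ^ 2 = 4 * ‖z‖ ^ 2 / (1 + ‖z‖ ^ 2) := by
    field_simp
    linear_combination (-4 : ℝ) * hs
  have e0 : 2 * (1 / (4 * ‖z‖ ^ 2 / (1 + ‖z‖ ^ 2))) * (2 * z.re / (1 + ‖z‖ ^ 2))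
      = (conj z)⁻¹.re := by
    rw [Complex.inv_re, Complex.normSq_conj, Complex.conj_re, Complex.normSq_eq_norm_sq]
    field_simp; norm_num
  have e1 : 2 * (1 / (4 * ‖z‖ ^ 2 / (1 + ‖z‖ ^ 2))) * (2 * z.im / (1 + ‖z‖ ^ 2))
      = (conj z)⁻¹.im := by
    rw [Complex.inv_im, Complex.normSq_conj, Complex.conj_im, Complex.normSq_eq_norm_sq]
    field_simp; norm_num
  have e2 : 1 - 2 * (1 / (4 * ‖z‖ ^ 2 / (1 + ‖z‖ ^ 2)))
      * (-1 * ((1 - ‖z‖ ^ 2) / (1 + ‖z‖ ^ 2)) + 1) = 0 := by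
    field_simp; ring
  rw [A_eq_coe hd (by positivity), e0, e1, e2]
  rfl

lemma T_emb_centre_odd {k l : ℤ} (hkl : Odd (k + l)) :
    T (emb (centre k l)) = OnePoint.infty := by
  have := Z_emb (k := k) (l := l) (z := 0) (by simp)
  rw [chart_zero, show reflect k l 0 = 0 by apply Complex.ext <;> simp [reflect], add_zero] at this
  rw [T, this, hkl.neg_one_zpow]
  simp [A]

lemma exists_cell (z : ℂ) :
    ∃ (k l : ℤ) (w : ℂ), ‖w‖ ≤ 1 ∧ z = centre k l + reflect k l (chart w) := by
  have hpi := Real.pi_pos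
  have key : ∀ t : ℝ, ∃ k : ℤ, |t - k * (Real.pi / 2)| ≤ Real.pi / 4 := fun t => by
    refine ⟨round (t / (Real.pi / 2)), ?_⟩
    have := abs_sub_round (t / (Real.pi / 2))
    rw [show t - round (t / (Real.pi / 2)) * (Real.pi / 2)
      = (t / (Real.pi / 2) - round (t / (Real.pi / 2))) * (Real.pi / 2) by field_simp, abs_mul,
      abs_of_pos (by positivity : 0 < Real.pi / 2)]
    nlinarith
  obtain ⟨k, hk⟩ := key z.re
  obtain ⟨l, hl⟩ := key z.im
  obtain ⟨w, hw, hwu⟩ := exists_chart_eq (u := reflect k l (z - centre k l)) (by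
    rw [M_reflect]
    exact max_le hk hl)
  refine ⟨k, l, w, hw, ?_⟩
  rw [hwu, reflect_reflect]; ring

/-! ### Inverse branches on the plane -/

/-- The map `scaledT lam` sends the point `z` of the plane to the finite point `w` of the plane. -/
def Step (lam : ℝ) (z w : ℂ) : Prop := scaledT lam (emb z) = (emb w : OnePoint R3)

/-- The image of a subset of the plane, without the point at infinity. -/
def img (lam : ℝ) (S : Set ℂ) : Set ℂ := {w | ∃ z ∈ S, Step lam z w}

/-- The set on which the inverse branch to the cell with index `(k, l)` is defined: a closed disk
if `k + l` is even, and the closure of its complement if `k + l` is odd. -/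
def Adm (lam : ℝ) (k l : ℤ) (w : ℂ) : Prop :=
  Even (k + l) ∧ ‖w‖ ≤ lam ∨ Odd (k + l) ∧ lam ≤ ‖w‖

/-- The inverse branch to the cell with index `(k, l)`. -/
def branch (lam : ℝ) (k l : ℤ) (w : ℂ) : ℂ :=
  centre k l + reflect k l (chart (if Even (k + l) then w / lam else (conj (w / lam))⁻¹))

/-- The images of the corners of the cells. -/
def cornerImages (lam : ℝ) : Set ℂ := {w | ‖w‖ = lam ∧ |w.re| = |w.im|}

lemma emb_injective : Function.Injective emb := fun z w hzw => by
  have h0 := congrArg (fun v : R3 => v 0) hzw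
  have h1 := congrArg (fun v : R3 => v 1) hzw
  exact Complex.ext (by simpa [emb] using h0) (by simpa [emb] using h1)

lemma smul_emb (c : ℝ) (z : ℂ) : c • emb z = emb (c * z) := by
  ext i
  fin_cases i <;> simp [emb]

lemma norm_emb (z : ℂ) : ‖emb z‖ = ‖z‖ := by
  rw [EuclideanSpace.norm_eq, Complex.norm_eq_sqrt_sq_add_sq, Fin.sum_univ_three]
  simp [emb]

lemma dist_emb (z w : ℂ) : dist (emb z) (emb w) = dist z w := by
  rw [dist_eq_norm, dist_eq_norm, ← norm_emb]
  congr 1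
  ext i
  fin_cases i <;> simp [emb]

lemma Step.unique {lam : ℝ} {z w w' : ℂ} (h : Step lam z w) (h' : Step lam z w') : w = w' :=
  emb_injective (OnePoint.coe_injective (h.symm.trans h'))

lemma finite_img {lam : ℝ} {S : Set ℂ} (hS : S.Finite) : (img lam S).Finite := by
  have : img lam S = ⋃ z ∈ S, {w | Step lam z w} := by ext w; simp [img]
  rw [this]
  exact hS.biUnion fun z _ => Set.Subsingleton.finite fun w hw w' hw' => Step.unique hw hw'

lemma branch_even {lam : ℝ} {k l : ℤ} (h : Even (k + l)) (w : ℂ) :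
    branch lam k l w = centre k l + reflect k l (chart (w / lam)) := by
  rw [branch, if_pos h]

lemma branch_odd {lam : ℝ} {k l : ℤ} (h : Odd (k + l)) (w : ℂ) :
    branch lam k l w = centre k l + reflect k l (chart (conj (w / lam))⁻¹) := by
  rw [branch, if_neg (Int.not_even_iff_odd.mpr h)]

section

variable {lam : ℝ} (hlam : 0 < lam)

include hlam

lemma norm_div_lam (w : ℂ) : ‖w / lam‖ = ‖w‖ / lam := by
  rw [norm_div, Complex.norm_real, Real.norm_of_nonneg hlam.le]

lemma norm_inv_conj_div (w : ℂ) : ‖(conj (w / lam))⁻¹‖ = lam / ‖w‖ := by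
  rw [norm_inv, Complex.norm_conj, norm_div_lam hlam, inv_div]

lemma step_branch {k l : ℤ} {w : ℂ} (h : Adm lam k l w) : Step lam (branch lam k l w) w := by
  have hl : (lam : ℂ) ≠ 0 := by exact_mod_cast hlam.ne'
  rcases h with ⟨he, hw⟩ | ⟨ho, hw⟩
  · rw [Step, branch_even he, scaledT, T_emb_even he, OnePoint.map_some, smul_emb, mul_div_cancel₀ _ hl]
    rw [norm_div_lam hlam]
    exact div_le_one_of_le₀ hw hlam.le
  · have hw0 : 0 < ‖w‖ := hlam.trans_le hw
    have h0 : (conj (w / lam))⁻¹ ≠ 0 := by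
      rw [← norm_pos_iff, norm_inv_conj_div hlam]; positivity
    rw [Step, branch_odd ho, scaledT, T_emb_odd ho _ h0, OnePoint.map_some, smul_emb, map_inv₀,
      inv_inv, Complex.conj_conj, mul_div_cancel₀ _ hl]
    rw [norm_inv_conj_div hlam]
    exact div_le_one_of_le₀ hw hw0.le

lemma exists_branch (z : ℂ) : scaledT lam (emb z) = OnePoint.infty ∨
    ∃ k l w, Adm lam k l w ∧ branch lam k l w = z := by
  have hl : (lam : ℂ) ≠ 0 := by exact_mod_cast hlam.ne'
  obtain ⟨k, l, w, hw, rfl⟩ := exists_cell z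
  rcases Int.even_or_odd (k + l) with he | ho
  · right
    refine ⟨k, l, lam * w, Or.inl ⟨he, ?_⟩, ?_⟩
    · rw [norm_mul, Complex.norm_real, Real.norm_of_nonneg hlam.le]
      exact mul_le_of_le_one_right hlam.le hw
    · rw [branch_even he, mul_div_cancel_left₀ _ hl]
  · rcases eq_or_ne w 0 with rfl | h0
    · left
      rw [chart_zero, show reflect k l 0 = 0 by apply Complex.ext <;> simp [reflect], add_zero,
        scaledT, T_emb_centre_odd ho, OnePoint.map_infty]
    · right
      have hw0 := norm_pos_iff.mpr h0
      refine ⟨k, l, lam * (conj w)⁻¹, Or.inr ⟨ho, ?_⟩, ?_⟩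
      · rw [norm_mul, Complex.norm_real, Real.norm_of_nonneg hlam.le, norm_inv, Complex.norm_conj]
        exact le_mul_of_one_le_right hlam.le ((one_le_inv₀ hw0).mpr hw)
      · rw [branch_odd ho, mul_div_cancel_left₀ _ hl, map_inv₀, inv_inv, Complex.conj_conj]

lemma Step.exists_branch {z w : ℂ} (h : Step lam z w) :
    ∃ k l, Adm lam k l w ∧ branch lam k l w = z := by
  rcases QRTangent.exists_branch hlam z with h' | ⟨k, l, w', hadm, rfl⟩
  · rw [Step, h'] at h
    exact absurd h (OnePoint.infty_ne_coe _)
  · obtain rfl := h.unique (step_branch hlam hadm)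
    exact ⟨k, l, hadm, rfl⟩

lemma dist_branch_le_of_even {k l : ℤ} (h : Even (k + l)) (w w' : ℂ) :
    dist (branch lam k l w) (branch lam k l w') ≤ 8 / lam * dist w w' := by
  rw [branch_even h, branch_even h, dist_add_left, dist_reflect]
  refine (dist_chart_le _ _).trans_eq ?_
  rw [dist_eq_norm, dist_eq_norm, ← sub_div, norm_div_lam hlam]
  ring

/-- The distance between inverses is the distance divided by the product of the norms. The resulting
factor R⁻² is what makes odd branches contract near ∞. -/
lemma dist_branch_le_of_odd {k l : ℤ} (h : Odd (k + l)) {R : ℝ} (hR : 0 < R) {w w' : ℂ}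
    (hw : R ≤ ‖w‖) (hw' : R ≤ ‖w'‖) :
    dist (branch lam k l w) (branch lam k l w') ≤ 8 * lam / R ^ 2 * dist w w' := by
  have h1 : 0 < ‖w‖ := hR.trans_le hw
  have h2 : 0 < ‖w'‖ := hR.trans_le hw'
  have n1 : conj (w / lam) ≠ 0 := by
    rw [← norm_pos_iff, Complex.norm_conj, norm_div_lam hlam]; positivity
  have n2 : conj (w' / lam) ≠ 0 := by
    rw [← norm_pos_iff, Complex.norm_conj, norm_div_lam hlam]; positivity
  rw [branch_odd h, branch_odd h, dist_add_left, dist_reflect]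
  refine (dist_chart_le _ _).trans ?_
  rw [dist_inv_inv₀ n1 n2, Complex.norm_conj, Complex.norm_conj, norm_div_lam hlam,
    norm_div_lam hlam, dist_eq_norm, ← map_sub, Complex.norm_conj, ← sub_div, norm_div_lam hlam,
    dist_eq_norm]
  calc 8 * (‖w - w'‖ / lam / (‖w‖ / lam * (‖w'‖ / lam)))
      = 8 * lam * ‖w - w'‖ / (‖w‖ * ‖w'‖) := by field_simp
    _ ≤ 8 * lam * ‖w - w'‖ / (R * R) := by gcongr
    _ = 8 * lam / R ^ 2 * ‖w - w'‖ := by ring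

lemma dist_branch_centre_le {k l : ℤ} (h : Odd (k + l)) (w : ℂ) :
    dist (branch lam k l w) (centre k l) ≤ 2 * lam / ‖w‖ := by
  rw [branch_odd h, dist_eq_norm, add_sub_cancel_left, norm_reflect]
  refine (norm_chart_le _).trans_eq ?_
  rw [norm_inv_conj_div hlam]
  ring

lemma continuousAt_branch {k l : ℤ} {w : ℂ} (h : Adm lam k l w) :
    ContinuousAt (branch lam k l) w := by
  rw [ContinuousAt, tendsto_iff_dist_tendsto_zero]
  rcases h with ⟨he, hw⟩ | ⟨ho, hw⟩
  · have : Tendsto (fun v : ℂ => 8 / lam * dist v w) (𝓝 w) (𝓝 0) := by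
      have : Continuous fun v : ℂ => 8 / lam * dist v w := by fun_prop
      simpa using this.tendsto w
    exact squeeze_zero (fun _ => dist_nonneg) (fun v => dist_branch_le_of_even hlam he v w) this
  · have : Tendsto (fun v : ℂ => 8 * lam / (lam / 2) ^ 2 * dist v w) (𝓝 w) (𝓝 0) := by
      have : Continuous fun v : ℂ => 8 * lam / (lam / 2) ^ 2 * dist v w := by fun_prop
      simpa using this.tendsto w
    have hev : ∀ᶠ v : ℂ in 𝓝 w, lam / 2 < ‖v‖ :=
      continuous_norm.continuousAt.eventually_const_lt (by linarith)
    refine squeeze_zero' (Eventually.of_forall fun _ => dist_nonneg) ?_ this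
    filter_upwards [hev] with v hv
    exact dist_branch_le_of_odd hlam ho (by positivity) hv.le (by linarith)

/-- Translation by mπ moves the cell index by 2m and so preserves parity and orientation. It
supplies preimages arbitrarily far away. -/
lemma Step.add_nat_mul_pi {z w : ℂ} (h : Step lam z w) (m : ℕ) :
    Step lam (z + (m * Real.pi : ℝ)) w := by
  obtain ⟨k, l, hadm, rfl⟩ := h.exists_branch hlam
  have hev : Even (k + 2 * m + l) ↔ Even (k + l) := by
    rw [show k + 2 * (m : ℤ) + l = (k + l) + 2 * m by ring, Int.even_add]; simp
  have hadm' : Adm lam (k + 2 * m) l w := by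
    rw [Adm, ← Int.not_even_iff_odd, hev, Int.not_even_iff_odd]; exact hadm
  have hs : (-1 : ℝ) ^ (k + 2 * (m : ℤ)) = (-1) ^ k := by
    rw [zpow_add₀ (by norm_num), zpow_mul]; simp
  have : branch lam (k + 2 * m) l w = branch lam k l w + (m * Real.pi : ℝ) := by
    simp only [branch, hev]
    apply Complex.ext
    · simp only [centre, reflect, Complex.add_re, hs, Complex.ofReal_re]; push_cast; ring
    · simp only [centre, reflect, Complex.add_im, Complex.ofReal_im]; ring
  rw [← this]
  exact step_branch hlam hadm'

/-! ### Adjacent cells -/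

/-- Inversion fixes the circle pointwise, so even and odd branches have the same formula there; this
lets adjacent cells be glued. -/
lemma branch_of_norm_eq (k l : ℤ) {w : ℂ} (hw : ‖w‖ = lam) :
    branch lam k l w = centre k l + reflect k l ((Real.pi / 4 / M w.re w.im : ℝ) * w) := by
  have hl : (lam : ℂ) ≠ 0 := by exact_mod_cast hlam.ne'
  have h1 : ‖w / lam‖ = 1 := by rw [norm_div_lam hlam, hw, div_self hlam.ne']
  have h2 : (conj (w / lam))⁻¹ = w / lam := by
    refine inv_eq_of_mul_eq_one_left ?_
    rw [Complex.mul_conj, Complex.normSq_eq_norm_sq, h1]; simp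
  have h3 : chart (w / lam) = (Real.pi / 4 / M w.re w.im : ℝ) * w := by
    have hre : (w / lam).re = lam⁻¹ * w.re := by rw [Complex.div_ofReal_re]; ring
    have him : (w / lam).im = lam⁻¹ * w.im := by rw [Complex.div_ofReal_im]; ring
    rw [chart, h1, Real.arctan_one, hre, him, M_mul_of_nonneg (by positivity)]
    push_cast
    field_simp
  rw [branch, h2, ite_self, h3]

lemma branch_succ_left {k l : ℤ} {w : ℂ} (hw : ‖w‖ = lam) (h : |w.im| ≤ (-1) ^ k * w.re) :
    branch lam (k + 1) l w = branch lam k l w := by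
  have h0 : 0 ≤ (-1) ^ k * w.re := (abs_nonneg _).trans h
  have hre : (-1) ^ k * w.re = M w.re w.im := by
    rw [M, ← abs_neg_one_zpow_mul k, abs_of_nonneg h0, max_eq_left h]
  have hM : 0 < M w.re w.im := M_pos (norm_pos_iff.mp (hw ▸ hlam))
  rw [branch_of_norm_eq hlam _ _ hw, branch_of_norm_eq hlam _ _ hw]
  apply Complex.ext
  · have e : (-1 : ℝ) ^ k * (Real.pi / 4 / M w.re w.im * w.re) = Real.pi / 4 := by
      rw [mul_left_comm, hre]; field_simp
    simp only [centre, reflect, Complex.add_re, Complex.re_ofReal_mul]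
    rw [zpow_add_one₀ (by norm_num)]
    push_cast
    linear_combination (-2 : ℝ) * e
  · simp only [centre, reflect, Complex.add_im, Complex.im_ofReal_mul]

lemma branch_succ_right {k l : ℤ} {w : ℂ} (hw : ‖w‖ = lam) (h : |w.re| ≤ (-1) ^ l * w.im) :
    branch lam k (l + 1) w = branch lam k l w := by
  have h0 : 0 ≤ (-1) ^ l * w.im := (abs_nonneg _).trans h
  have him : (-1) ^ l * w.im = M w.re w.im := by
    rw [M, ← abs_neg_one_zpow_mul l w.im, abs_of_nonneg h0, max_eq_right h]
  have hM : 0 < M w.re w.im := M_pos (norm_pos_iff.mp (hw ▸ hlam))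
  rw [branch_of_norm_eq hlam _ _ hw, branch_of_norm_eq hlam _ _ hw]
  apply Complex.ext
  · simp only [centre, reflect, Complex.add_re, Complex.re_ofReal_mul]
  · have e : (-1 : ℝ) ^ l * (Real.pi / 4 / M w.re w.im * w.im) = Real.pi / 4 := by
      rw [mul_left_comm, him]; field_simp
    simp only [centre, reflect, Complex.add_im, Complex.im_ofReal_mul]
    rw [zpow_add_one₀ (by norm_num)]
    push_cast
    linear_combination (-2 : ℝ) * e

/-- Every point on the boundary of a cell belongs to an adjacent cell, and unless it is a corner,
the two inverse branches agree near its image, where both are defined. -/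
lemma exists_adjacent (k l : ℤ) {w : ℂ} (hw : ‖w‖ = lam) :
    ∃ k' l', (Even (k' + l') ↔ Odd (k + l)) ∧ branch lam k' l' w = branch lam k l w ∧
      (w ∉ cornerImages lam → ∀ᶠ v in 𝓝 w, ‖v‖ = lam → branch lam k' l' v = branch lam k l v) := by
  have hsgn : ∀ (j : ℤ) (a b : ℝ), |b| ≤ |a| → |b| ≤ (-1) ^ j * a ∨ |b| ≤ (-1) ^ (j - 1) * a := by
    intro j a b hab
    rw [zpow_sub_one₀ (by norm_num)]
    rcases abs_choice ((-1) ^ j * a) with hc | hc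
    · left; rwa [← hc, abs_neg_one_zpow_mul]
    · right; rw [show (-1 : ℝ) ^ j * (-1)⁻¹ * a = -((-1) ^ j * a) by norm_num, ← hc]
      rwa [abs_neg_one_zpow_mul]
  have hne : w ∉ cornerImages lam → |w.re| ≠ |w.im| := fun h h' => h ⟨hw, h'⟩
  have evre : ∀ j : ℤ, |w.im| ≤ (-1) ^ j * w.re → w ∉ cornerImages lam →
      ∀ᶠ v : ℂ in 𝓝 w, |v.im| ≤ (-1) ^ j * v.re := by
    intro j hj hc
    have hlt : |w.im| < (-1) ^ j * w.re := by
      refine lt_of_le_of_ne hj fun h => hne hc ?_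
      rw [← abs_neg_one_zpow_mul j, ← h, abs_abs]
    have c1 : ContinuousAt (fun v : ℂ => |v.im|) w := by fun_prop
    have c2 : ContinuousAt (fun v : ℂ => (-1 : ℝ) ^ j * v.re) w := by fun_prop
    exact (c1.eventually_lt c2 hlt).mono fun v hv => hv.le
  have evim : ∀ j : ℤ, |w.re| ≤ (-1) ^ j * w.im → w ∉ cornerImages lam →
      ∀ᶠ v : ℂ in 𝓝 w, |v.re| ≤ (-1) ^ j * v.im := by
    intro j hj hc
    have hlt : |w.re| < (-1) ^ j * w.im := by
      refine lt_of_le_of_ne hj fun h => hne hc ?_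
      rw [← abs_neg_one_zpow_mul j w.im, ← h, abs_abs]
    have c1 : ContinuousAt (fun v : ℂ => |v.re|) w := by fun_prop
    have c2 : ContinuousAt (fun v : ℂ => (-1 : ℝ) ^ j * v.im) w := by fun_prop
    exact (c1.eventually_lt c2 hlt).mono fun v hv => hv.le
  rcases le_total |w.im| |w.re| with hle | hle
  · rcases hsgn k _ _ hle with h | h
    · refine ⟨k + 1, l, by grind, branch_succ_left hlam hw h, fun hc => ?_⟩
      filter_upwards [evre k h hc] with v hv hv'
      exact branch_succ_left hlam hv' hv
    · have key : ∀ v : ℂ, ‖v‖ = lam → |v.im| ≤ (-1) ^ (k - 1) * v.re →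
          branch lam (k - 1) l v = branch lam k l v := fun v hv hv' => by
        rw [← branch_succ_left hlam hv hv', sub_add_cancel]
      refine ⟨k - 1, l, by grind, key w hw h, fun hc => ?_⟩
      filter_upwards [evre _ h hc] with v hv hv'
      exact key v hv' hv
  · rcases hsgn l _ _ hle with h | h
    · refine ⟨k, l + 1, by grind, branch_succ_right hlam hw h, fun hc => ?_⟩
      filter_upwards [evim l h hc] with v hv hv'
      exact branch_succ_right hlam hv' hv
    · have key : ∀ v : ℂ, ‖v‖ = lam → |v.re| ≤ (-1) ^ (l - 1) * v.im →
          branch lam k (l - 1) v = branch lam k l v := fun v hv hv' => by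
        rw [← branch_succ_right hlam hv hv', sub_add_cancel]
      refine ⟨k, l - 1, by grind, key w hw h, fun hc => ?_⟩
      filter_upwards [evim _ h hc] with v hv hv'
      exact key v hv' hv

/-- A preimage under a step, on the boundary of its cell, lies in an even and in an odd cell. -/
lemma Step.exists_branch_even_odd {z w : ℂ} (h : Step lam z w) (hw : ‖w‖ = lam) :
    ∃ k l k' l', Even (k + l) ∧ Odd (k' + l') ∧ branch lam k l w = z ∧ branch lam k' l' w = z ∧
      (w ∉ cornerImages lam → ∀ᶠ v in 𝓝 w, ‖v‖ = lam → branch lam k l v = branch lam k' l' v) := by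
  obtain ⟨k, l, -, hz⟩ := h.exists_branch hlam
  obtain ⟨k', l', hp, he, hev⟩ := exists_adjacent hlam k l hw
  rcases Int.even_or_odd (k + l) with h1 | h1
  · refine ⟨k, l, k', l', h1, ?_, hz, he.trans hz, fun hc => (hev hc).mono fun v hv h => (hv h).symm⟩
    rw [← Int.not_even_iff_odd, hp, Int.not_odd_iff_even]; exact h1
  · exact ⟨k', l', k, l, hp.mpr h1, h1, he.trans hz, hz, hev⟩

/-- Over the circle, an even branch covers the inner side and an odd branch the outer side. Both
only need to pass through z, so corners need no exception. -/
lemma isOpen_img {S : Set ℂ} (hS : IsOpen S) : IsOpen (img lam S) := by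
  rw [isOpen_iff_mem_nhds]
  rintro w ⟨z, hz, hzw⟩
  obtain ⟨k, l, hadm, hb⟩ := hzw.exists_branch hlam
  have near : ∀ {k l : ℤ}, Adm lam k l w → branch lam k l w = z →
      ∀ᶠ v in 𝓝 w, branch lam k l v ∈ S := fun ha hb =>
    (continuousAt_branch hlam ha).eventually_mem (by rw [hb]; exact hS.mem_nhds hz)
  rcases lt_trichotomy ‖w‖ lam with hlt | heq | hgt
  · have he : Even (k + l) := by
      rcases hadm with h | h
      · exact h.1
      · linarith [h.2]
    filter_upwards [near hadm hb, continuous_norm.continuousAt.eventually_lt_const hlt]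
      with v hv hv'
    exact ⟨_, hv, step_branch hlam (Or.inl ⟨he, hv'.le⟩)⟩
  · obtain ⟨k, l, k', l', he, ho, hb, hb', -⟩ := hzw.exists_branch_even_odd hlam heq
    filter_upwards [near (Or.inl ⟨he, heq.le⟩) hb, near (Or.inr ⟨ho, heq.ge⟩) hb'] with v hv hv'
    rcases le_total ‖v‖ lam with h | h
    · exact ⟨_, hv, step_branch hlam (Or.inl ⟨he, h⟩)⟩
    · exact ⟨_, hv', step_branch hlam (Or.inr ⟨ho, h⟩)⟩
  · have ho : Odd (k + l) := by
      rcases hadm with h | h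
      · linarith [h.2]
      · exact h.1
    filter_upwards [near hadm hb, continuous_norm.continuousAt.eventually_const_lt hgt]
      with v hv hv'
    exact ⟨_, hv, step_branch hlam (Or.inr ⟨ho, hv'.le⟩)⟩

end

/-! ### Lipschitz sections -/

/-- The `n`-th iterate has a Lipschitz right inverse near `w` that maps `w` to `y`. -/
def HasSection (lam : ℝ) (n : ℕ) (y w : ℂ) : Prop :=
  ∃ (g : ℂ → ℂ) (L : ℝ≥0) (δ : ℝ), 0 < δ ∧ LipschitzOnWith L g (ball w δ) ∧ g w = y ∧
    ∀ v ∈ ball w δ, iter (scaledT lam) n (emb (g v)) = (emb v : OnePoint R3)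

lemma iter_one_iff {lam : ℝ} {z w : ℂ} :
    iter (scaledT lam) 1 (emb z) = (emb w : OnePoint R3) ↔ Step lam z w := Iff.rfl

lemma iter_succ_of_step {lam : ℝ} {n : ℕ} {x : R3} {z w : ℂ}
    (h : iter (scaledT lam) n x = (emb z : OnePoint R3)) (h' : Step lam z w) :
    iter (scaledT lam) (n + 1) x = (emb w : OnePoint R3) := by
  rw [iter, Function.iterate_succ_apply']
  exact (congrArg _ h).trans h'

lemma hasSection_zero (lam : ℝ) (y : ℂ) : HasSection lam 0 y y :=
  ⟨id, 1, 1, one_pos, LipschitzWith.id.lipschitzOnWith, rfl, fun _ _ => rfl⟩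

lemma HasSection.succ {lam : ℝ} {n : ℕ} {y z w : ℂ} (h : HasSection lam n y z)
    (h' : HasSection lam 1 z w) : HasSection lam (n + 1) y w := by
  -- The radius below is divided by L' + 1 rather than L', which may be zero.
  obtain ⟨g, L, δ, hδ, hg, hgz, hs⟩ := h
  obtain ⟨g', L', δ', hδ', hg', hgw, hs'⟩ := h'
  have hpos : (0 : ℝ) < L' + 1 := by positivity
  have hmaps : Set.MapsTo g' (ball w (min δ' (δ / (L' + 1)))) (ball z δ) := fun v hv => by
    have hv1 : v ∈ ball w δ' := ball_subset_ball (min_le_left _ _) hv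
    have hv2 : dist v w < δ / (L' + 1) := (mem_ball.mp hv).trans_le (min_le_right _ _)
    rw [lt_div_iff₀ hpos] at hv2
    have := hg'.dist_le_mul v hv1 w (mem_ball_self hδ')
    rw [hgw] at this
    rw [mem_ball]
    nlinarith [dist_nonneg (x := v) (y := w)]
  refine ⟨g ∘ g', L * L', min δ' (δ / (L' + 1)), by positivity,
    hg.comp (hg'.mono (ball_subset_ball (min_le_left _ _))) hmaps, by simp [hgw, hgz],
    fun v hv => ?_⟩
  exact iter_succ_of_step (hs _ (hmaps hv))
    (iter_one_iff.mp (hs' v (ball_subset_ball (min_le_left _ _) hv)))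

/-- Lipschitz maps on both sides of a circle that agree on the circle. -/
lemma dist_le_of_norm_le_of_le_norm {r K K' : ℝ} {s : Set ℂ} {f f' : ℂ → ℂ} (hs : Convex ℝ s)
    (hK : 0 ≤ K) (hK' : 0 ≤ K')
    (hf : ∀ v ∈ s, ∀ w ∈ s, ‖v‖ ≤ r → ‖w‖ ≤ r → dist (f v) (f w) ≤ K * dist v w)
    (hf' : ∀ v ∈ s, ∀ w ∈ s, r ≤ ‖v‖ → r ≤ ‖w‖ → dist (f' v) (f' w) ≤ K' * dist v w)
    (heq : ∀ v ∈ s, ‖v‖ = r → f v = f' v) {v w : ℂ} (hv : v ∈ s) (hw : w ∈ s) (hvr : ‖v‖ ≤ r)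
    (hwr : r ≤ ‖w‖) : dist (f v) (f' w) ≤ (K + K') * dist v w := by
  have hc : Continuous fun t : ℝ => ‖AffineMap.lineMap (k := ℝ) v w t‖ :=
    continuous_norm.comp AffineMap.lineMap_continuous
  -- The segment from v to w meets the circle, where f and f' agree; the triangle inequality is
  -- applied through that point.
  obtain ⟨t, ht, hx⟩ := intermediate_value_Icc (zero_le_one' ℝ) hc.continuousOn
    (show r ∈ Set.Icc _ _ by simpa using ⟨hvr, hwr⟩)
  simp only at hx
  set x := AffineMap.lineMap (k := ℝ) v w t
  have hxs : x ∈ s := hs.lineMap_mem hv hw ht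
  have d1 : dist v x ≤ dist v w := by
    rw [dist_left_lineMap, Real.norm_of_nonneg ht.1]
    exact mul_le_of_le_one_left dist_nonneg ht.2
  have d2 : dist x w ≤ dist v w := by
    rw [dist_lineMap_right, Real.norm_of_nonneg (by linarith [ht.2])]
    exact mul_le_of_le_one_left dist_nonneg (by linarith [ht.1])
  have e1 := hf v hv x hxs hvr hx.le
  have e2 := hf' x hxs w hw hx.ge hwr
  rw [← heq x hxs hx] at e2
  calc dist (f v) (f' w) ≤ dist (f v) (f x) + dist (f x) (f' w) := dist_triangle _ _ _
    _ ≤ K * dist v x + K' * dist x w := add_le_add e1 e2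
    _ ≤ K * dist v w + K' * dist v w := by gcongr
    _ = (K + K') * dist v w := by ring

/-- Over the circle the section is glued from an even and an odd branch. Away from corner images
they agree on a whole arc, so the result is Lipschitz. -/
lemma Step.hasSection {lam : ℝ} (hlam : 0 < lam) {z w : ℂ} (h : Step lam z w)
    (hw : w ∉ cornerImages lam) : HasSection lam 1 z w := by
  have hK : (0 : ℝ) ≤ 8 / lam := by positivity
  have hK' : (0 : ℝ) ≤ 8 * lam / lam ^ 2 := by positivity
  obtain ⟨k, l, hadm, hb⟩ := h.exists_branch hlam
  rcases lt_trichotomy ‖w‖ lam with hlt | heq | hgt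
  · have he : Even (k + l) := by
      rcases hadm with h | h
      · exact h.1
      · linarith [h.2]
    obtain ⟨δ, hδ, hball⟩ := eventually_nhds_iff_ball.mp
      (continuous_norm.continuousAt.eventually_lt_const hlt)
    refine ⟨branch lam k l, ⟨8 / lam, hK⟩, δ, hδ, LipschitzOnWith.of_dist_le_mul
      fun v _ v' _ => dist_branch_le_of_even hlam he v v', hb, fun v hv => ?_⟩
    exact step_branch hlam (Or.inl ⟨he, (hball v hv).le⟩)
  · obtain ⟨k, l, k', l', he, ho, hb, hb', hev⟩ := h.exists_branch_even_odd hlam heq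
    obtain ⟨δ, hδ, hball⟩ := eventually_nhds_iff_ball.mp (hev hw)
    have mixed : ∀ v ∈ ball w δ, ∀ v' ∈ ball w δ, ‖v‖ ≤ lam → lam ≤ ‖v'‖ →
        dist (branch lam k l v) (branch lam k' l' v') ≤ (8 / lam + 8 * lam / lam ^ 2) * dist v v' :=
      fun v hv v' hv' h1 h2 => dist_le_of_norm_le_of_le_norm (convex_ball w δ) hK hK'
        (fun a _ b _ _ _ => dist_branch_le_of_even hlam he a b)
        (fun a _ b _ ha hb => dist_branch_le_of_odd hlam ho hlam ha hb) hball hv hv' h1 h2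
    refine ⟨fun v => if ‖v‖ ≤ lam then branch lam k l v else branch lam k' l' v,
      ⟨8 / lam + 8 * lam / lam ^ 2, add_nonneg hK hK'⟩, δ, hδ,
      LipschitzOnWith.of_dist_le_mul fun v hv v' hv' => ?_, ?_, fun v _ => ?_⟩
    · change _ ≤ (8 / lam + 8 * lam / lam ^ 2) * dist v v'
      split_ifs with h1 h2 h2
      · refine (dist_branch_le_of_even hlam he v v').trans ?_
        gcongr
        linarith
      · exact mixed v hv v' hv' h1 (not_le.mp h2).le
      · rw [dist_comm, dist_comm v]
        exact mixed v' hv' v hv h2 (not_le.mp h1).le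
      · refine (dist_branch_le_of_odd hlam ho hlam (not_le.mp h1).le (not_le.mp h2).le).trans ?_
        gcongr
        linarith
    · simp only [heq, le_refl, if_true]; exact hb
    · rw [iter_one_iff]
      dsimp only
      split_ifs with h1
      · exact step_branch hlam (Or.inl ⟨he, h1⟩)
      · exact step_branch hlam (Or.inr ⟨ho, (not_le.mp h1).le⟩)
  · have ho : Odd (k + l) := by
      rcases hadm with h | h
      · linarith [h.2]
      · exact h.1
    obtain ⟨δ, hδ, hball⟩ := eventually_nhds_iff_ball.mp
      (continuous_norm.continuousAt.eventually_const_lt hgt)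
    refine ⟨branch lam k l, ⟨8 * lam / lam ^ 2, hK'⟩, δ, hδ, LipschitzOnWith.of_dist_le_mul
      fun v hv v' hv' => dist_branch_le_of_odd hlam ho hlam (hball v hv).le (hball v' hv').le,
      hb, fun v hv => ?_⟩
    exact step_branch hlam (Or.inr ⟨ho, (hball v hv).le⟩)

/-- A point of an iterated image that avoids the forward orbits of the corners is the image of a
point with a Lipschitz section. -/
lemma exists_hasSection {lam : ℝ} (hlam : 0 < lam) {U : Set ℂ} (n : ℕ) {w : ℂ}
    (hw : w ∈ (img lam)^[n] U) (hc : ∀ j ≤ n, w ∉ (img lam)^[j] (cornerImages lam)) :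
    ∃ y ∈ U, y ∉ cornerImages lam ∧ HasSection lam n y w := by
  induction n generalizing w with
  | zero => exact ⟨w, hw, hc 0 le_rfl, hasSection_zero lam w⟩
  | succ n ih =>
    rw [Function.iterate_succ_apply'] at hw
    obtain ⟨z, hz, hzw⟩ := hw
    obtain ⟨y, hy, hyc, hs⟩ := ih hz fun j hj hzj => hc (j + 1) (by omega) (by
      rw [Function.iterate_succ_apply']; exact ⟨z, hzj, hzw⟩)
    exact ⟨y, hy, hyc, hs.succ (hzw.hasSection hlam (hc 0 (Nat.zero_le _)))⟩

lemma finite_cornerImages (lam : ℝ) : (cornerImages lam).Finite := by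
  set r := lam / √2 with hr
  have hfin : (((fun p : ℝ × ℝ => (⟨p.1, p.2⟩ : ℂ)) '' ({r, -r} ×ˢ {r, -r})) : Set ℂ).Finite :=
    ((Set.toFinite {r, -r}).prod (Set.toFinite {r, -r})).image _
  refine hfin.subset fun w hw => ?_
  obtain ⟨h1, h2⟩ := hw
  have hl : 0 ≤ lam := h1 ▸ norm_nonneg w
  have h3 : ‖w‖ ^ 2 = w.re ^ 2 + w.im ^ 2 := by rw [Complex.sq_norm, Complex.normSq_apply]; ring
  have h4 : w.re ^ 2 = w.im ^ 2 := sq_eq_sq_iff_abs_eq_abs _ _ |>.mpr h2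
  have h5 : r ^ 2 = lam ^ 2 / 2 := by rw [hr, div_pow, Real.sq_sqrt (by norm_num)]
  rw [h1] at h3
  have h6 : w.re ^ 2 = r ^ 2 := by rw [h5]; linarith
  have h7 : w.im ^ 2 = r ^ 2 := by rw [h5]; linarith
  exact ⟨(w.re, w.im), ⟨sq_eq_sq_iff_eq_or_eq_neg.mp h6, sq_eq_sq_iff_eq_or_eq_neg.mp h7⟩, rfl⟩

/-! ### Escaping points lie in the plane `z = 0` -/

lemma sum_sq_h (x y : ℝ) : h x y 0 ^ 2 + h x y 1 ^ 2 + h x y 2 ^ 2 = 1 := by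
  have e0 : h x y 0 = x * Real.sin (M x y) / √(x ^ 2 + y ^ 2) := rfl
  have e1 : h x y 1 = y * Real.sin (M x y) / √(x ^ 2 + y ^ 2) := rfl
  have e2 : h x y 2 = Real.cos (M x y) := rfl
  rw [e0, e1, e2, div_pow, div_pow, Real.sq_sqrt (by positivity)]
  by_cases h0 : x ^ 2 + y ^ 2 = 0
  · have hx : x = 0 := by nlinarith [sq_nonneg x, sq_nonneg y]
    have hy : y = 0 := by nlinarith [sq_nonneg x, sq_nonneg y]
    simp [hx, hy, M]
  · rw [← add_div, show (x * Real.sin (M x y)) ^ 2 + (y * Real.sin (M x y)) ^ 2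
      = Real.sin (M x y) ^ 2 * (x ^ 2 + y ^ 2) by ring, mul_div_cancel_right₀ _ h0]
    exact Real.sin_sq_add_cos_sq _

lemma sum_sq_Z (p : R3) : Z p 0 ^ 2 + Z p 1 ^ 2 + Z p 2 ^ 2 = Real.exp (p 2) ^ 2 := by
  set w := h (fold (p 0)) (fold (p 1)) with hw
  have e0 : Z p 0 = Real.exp (p 2) * w 0 := rfl
  have e1 : Z p 1 = Real.exp (p 2) * w 1 := rfl
  have e2 : Z p 2 = Real.exp (p 2) * ((-1) ^ (cell (p 0) + cell (p 1)) * w 2) := rfl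
  have hs : w 0 ^ 2 + w 1 ^ 2 + w 2 ^ 2 = 1 := sum_sq_h _ _
  have h1 := neg_one_zpow_mul_self (cell (p 0) + cell (p 1))
  rw [e0, e1, e2]
  linear_combination Real.exp (p 2) ^ 2 * hs + Real.exp (p 2) ^ 2 * w 2 ^ 2 * h1

lemma third_and_norm_of_A_eq_coe {v q : R3} (hq : A v = (q : OnePoint R3)) :
    0 < v 0 ^ 2 + v 1 ^ 2 + (v 2 + 1) ^ 2 ∧
    q 2 * (v 0 ^ 2 + v 1 ^ 2 + (v 2 + 1) ^ 2) = v 0 ^ 2 + v 1 ^ 2 + v 2 ^ 2 - 1 ∧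
    ‖q‖ ^ 2 * (v 0 ^ 2 + v 1 ^ 2 + (v 2 + 1) ^ 2) =
      v 0 ^ 2 + v 1 ^ 2 + (v 2 + 1) ^ 2 - 4 * v 2 := by
  have hv : A v = if v 0 ^ 2 + v 1 ^ 2 + (v 2 + 1) ^ 2 = 0 then OnePoint.infty else
      ((!₂[2 * (1 / (v 0 ^ 2 + v 1 ^ 2 + (v 2 + 1) ^ 2)) * v 0,
        2 * (1 / (v 0 ^ 2 + v 1 ^ 2 + (v 2 + 1) ^ 2)) * v 1,
        1 - 2 * (1 / (v 0 ^ 2 + v 1 ^ 2 + (v 2 + 1) ^ 2)) * (v 2 + 1)] : R3) : OnePoint R3) := rfl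
  set d := v 0 ^ 2 + v 1 ^ 2 + (v 2 + 1) ^ 2 with hd
  by_cases h0 : d = 0
  · rw [hv, if_pos h0] at hq
    exact absurd hq (OnePoint.infty_ne_coe _)
  have hpos : 0 < d := lt_of_le_of_ne (by positivity) (Ne.symm h0)
  rw [hv, if_neg h0] at hq
  obtain rfl := OnePoint.coe_injective hq
  refine ⟨hpos, ?_, ?_⟩
  · change (1 - 2 * (1 / d) * (v 2 + 1)) * d = _
    have : (1 - 2 * (1 / d) * (v 2 + 1)) * d = d - 2 * (v 2 + 1) := by field_simp
    rw [this, hd]; ring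
  · rw [EuclideanSpace.norm_sq_eq, Fin.sum_univ_three]
    simp only [Real.norm_eq_abs, sq_abs]
    change ((2 * (1 / d) * v 0) ^ 2 + (2 * (1 / d) * v 1) ^ 2
      + (1 - 2 * (1 / d) * (v 2 + 1)) ^ 2) * d = _
    field_simp
    linear_combination (-4 : ℝ) * hd

lemma exists_scaledT_eq_coe {lam : ℝ} {p w : R3} (h : scaledT lam p = (w : OnePoint R3)) :
    ∃ q : R3, T p = (q : OnePoint R3) ∧ w = lam • q := by
  rw [scaledT] at h
  induction hT : T p with
  | infty => rw [hT, OnePoint.map_infty] at h; exact absurd h (OnePoint.infty_ne_coe _)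
  | coe q =>
    rw [hT, OnePoint.map_some] at h
    exact ⟨q, rfl, (OnePoint.coe_injective h).symm⟩

lemma sum_sq_Z_two_smul (p : R3) :
    Z ((2 : ℝ) • p) 0 ^ 2 + Z ((2 : ℝ) • p) 1 ^ 2 + Z ((2 : ℝ) • p) 2 ^ 2
      = Real.exp (2 * p 2) ^ 2 := sum_sq_Z _

lemma third_eq_zero_of_image {lam : ℝ} (hlam : 0 < lam) {p w : R3}
    (h : scaledT lam p = (w : OnePoint R3)) (hw : w 2 = 0) : p 2 = 0 := by
  obtain ⟨q, hq, rfl⟩ := exists_scaledT_eq_coe h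
  obtain ⟨-, h2, -⟩ := third_and_norm_of_A_eq_coe hq
  have hq2 : q 2 = 0 := by
    have : lam * q 2 = 0 := hw
    exact (mul_eq_zero.mp this).resolve_left hlam.ne'
  rw [hq2, zero_mul, sum_sq_Z_two_smul] at h2
  have h3 : Real.exp (2 * p 2) ^ 2 = 1 := by linarith
  have h4 : Real.exp (2 * p 2) = 1 := (pow_eq_one_iff_of_nonneg (Real.exp_nonneg _) two_ne_zero).mp h3
  rw [Real.exp_eq_one_iff] at h4
  linarith

/-- A large image means that Z(2p) is close to the pole of A: its squared distance d satisfies 2Kd ≤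
e, where e = exp(2 p₂). This keeps e between 1/2 and 2, so |p₂| ≤ |e² − 1| = |q₂| d with dK ≤ 1. -/
lemma third_expanding_of_large {p q : R3} {K : ℝ} (hK : 2 ≤ K) (h : T p = (q : OnePoint R3))
    (hq : 8 * K + 1 ≤ ‖q‖ ^ 2) : |p 2| ≤ 1 ∧ K * |p 2| ≤ |q 2| := by
  obtain ⟨h1, h2, h3⟩ := third_and_norm_of_A_eq_coe h
  have hs := sum_sq_Z_two_smul p
  rw [hs] at h2
  set v := Z ((2 : ℝ) • p)
  set d := v 0 ^ 2 + v 1 ^ 2 + (v 2 + 1) ^ 2 with hd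
  set e := Real.exp (2 * p 2) with he
  have hepos : 0 < e := Real.exp_pos _
  have hv2 : |v 2| ≤ e := abs_le_of_sq_le_sq (by nlinarith [sq_nonneg (v 0), sq_nonneg (v 1)]) hepos.le
  rw [abs_le] at hv2
  have hd2 : d = e ^ 2 + 2 * v 2 + 1 := by rw [← hs, hd]; ring
  have hd3 : (1 - e) ^ 2 ≤ d := by rw [hd2]; nlinarith
  have hd4 : d * (2 * K) ≤ e := by
    have := mul_le_mul_of_nonneg_right hq h1.le
    linarith
  have hd5 : (1 - e) ^ 2 * 4 ≤ e := by
    have : d * 4 ≤ d * (2 * K) := mul_le_mul_of_nonneg_left (by linarith) h1.le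
    linarith
  have he2 : e < 2 := by nlinarith
  have he1 : 1 / 2 < e := by nlinarith
  have hexp1 : 2 * p 2 + 1 ≤ e := Real.add_one_le_exp _
  have hexp2 : -(2 * p 2) + 1 ≤ e⁻¹ := by rw [he, ← Real.exp_neg]; exact Real.add_one_le_exp _
  have hinv : e⁻¹ < 2 := by rw [inv_lt_comm₀ hepos two_pos]; linarith
  have hexp3 : (-(2 * p 2) + 1) * e ≤ 1 := by
    calc (-(2 * p 2) + 1) * e ≤ e⁻¹ * e := by gcongr
      _ = 1 := inv_mul_cancel₀ hepos.ne'
  have hz : |p 2| ≤ |e ^ 2 - 1| := by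
    rcases le_total 0 (p 2) with hp | hp
    · rw [abs_of_nonneg hp]
      refine le_trans ?_ (le_abs_self _)
      have h1e : 1 ≤ e := by linarith
      have : e ≤ e ^ 2 := le_self_pow₀ h1e two_ne_zero
      linarith
    · rw [abs_of_nonpos hp]
      refine le_trans ?_ (neg_le_abs _)
      have hpe : -p 2 * 1 ≤ -p 2 * (2 * e) :=
        mul_le_mul_of_nonneg_left (by linarith) (by linarith)
      have h1e : e ≤ 1 := by linarith
      have : e ^ 2 ≤ e := pow_le_of_le_one hepos.le h1e two_ne_zero
      linarith
  refine ⟨abs_le.mpr ⟨by linarith, by linarith⟩, ?_⟩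
  have hq2 : |q 2| * d = |e ^ 2 - 1| := by rw [← h2, abs_mul, abs_of_pos h1]
  rw [← hq2] at hz
  have hdK : d * K ≤ 1 := by linarith
  calc K * |p 2| ≤ K * (|q 2| * d) := by gcongr
    _ = |q 2| * (d * K) := by ring
    _ ≤ |q 2| * 1 := by gcongr
    _ = |q 2| := mul_one _

lemma exists_third_expanding {lam : ℝ} (hlam : 0 < lam) : ∃ R : ℝ, ∀ p w : R3,
    scaledT lam p = (w : OnePoint R3) → R ≤ ‖w‖ → |p 2| ≤ 1 ∧ 2 * |p 2| ≤ |w 2| := by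
  -- Chosen so that K ≥ 2 and `lam` · K ≥ 2.
  set K := 2 + 2 / lam with hK
  have hK2 : 2 ≤ K := by have : 0 < 2 / lam := by positivity
                         linarith
  refine ⟨lam * (8 * K + 1), fun p w h hw => ?_⟩
  obtain ⟨q, hq, rfl⟩ := exists_scaledT_eq_coe h
  rw [norm_smul, Real.norm_of_nonneg hlam.le] at hw
  have hqn : 8 * K + 1 ≤ ‖q‖ := le_of_mul_le_mul_left hw hlam
  obtain ⟨h1, h2⟩ := third_expanding_of_large hK2 hq (by nlinarith)
  refine ⟨h1, ?_⟩
  have hlK : 2 ≤ lam * K := by rw [hK, mul_add, mul_div_cancel₀ _ hlam.ne']; linarith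
  calc 2 * |p 2| ≤ lam * K * |p 2| := by gcongr
    _ = lam * (K * |p 2|) := by ring
    _ ≤ lam * |q 2| := by gcongr
    _ = |(lam • q) 2| := by
      rw [PiLp.smul_apply, smul_eq_mul, abs_mul, abs_of_pos hlam]

lemma exists_orbit {f : R3 → OnePoint R3} {x : R3} (hx : x ∈ escapingSet f) :
    ∃ o : ℕ → R3, o 0 = x ∧ (∀ k, f (o k) = (o (k + 1) : OnePoint R3)) ∧
      Tendsto (fun k => ‖o k‖) atTop atTop := by
  obtain ⟨h1, h2⟩ := hx
  have hfin : ∀ k, ∃ y : R3, iter f k x = (y : OnePoint R3) := by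
    intro k
    rcases Nat.eq_zero_or_pos k with rfl | hk
    · exact ⟨x, rfl⟩
    · obtain ⟨y, hy⟩ := OnePoint.ne_infty_iff_exists.mp fun h => h1 ⟨k, hk, h⟩
      exact ⟨y, hy.symm⟩
  choose o ho using hfin
  refine ⟨o, (OnePoint.coe_injective (ho 0)).symm, fun k => ?_, ?_⟩
  · rw [← ho (k + 1), iter, Function.iterate_succ_apply']
    exact congrArg (extend f) (ho k).symm
  · simp only [ho] at h2
    have h3 : Tendsto o atTop (comap ((↑) : R3 → OnePoint R3) (𝓝 OnePoint.infty)) :=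
      tendsto_comap_iff.mpr h2
    rw [OnePoint.comap_coe_nhds_infty, coclosedCompact_eq_cocompact] at h3
    exact (tendsto_norm_cocompact_atTop (E := R3)).comp h3

lemma exists_planar_orbit {lam : ℝ} (hlam : 0 < lam) {x : R3} (hx : x ∈ escapingSet (scaledT lam)) :
    ∃ o : ℕ → ℂ, emb (o 0) = x ∧ (∀ k, Step lam (o k) (o (k + 1))) ∧
      Tendsto (fun k => ‖o k‖) atTop atTop := by
  obtain ⟨o, h0, hstep, ht⟩ := exists_orbit hx
  obtain ⟨R, hR⟩ := exists_third_expanding hlam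
  obtain ⟨N, hN⟩ := eventually_atTop.mp (ht.eventually_ge_atTop R)
  have hexp : ∀ k, N ≤ k → |o k 2| ≤ 1 ∧ 2 * |o k 2| ≤ |o (k + 1) 2| := fun k hk =>
    hR _ _ (hstep k) (hN _ (by omega))
  have hlarge : ∀ k, N ≤ k → o k 2 = 0 := by
    intro k hk
    by_contra hne
    have hgrow : ∀ j : ℕ, 2 ^ j * |o k 2| ≤ |o (k + j) 2| := by
      intro j
      induction j with
      | zero => simp
      | succ j ih =>
        have := (hexp (k + j) (by omega)).2
        rw [pow_succ, ← add_assoc]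
        linarith
    obtain ⟨j, hj⟩ := pow_unbounded_of_one_lt (1 / |o k 2|) one_lt_two
    rw [div_lt_iff₀ (abs_pos.mpr hne)] at hj
    linarith [hgrow j, (hexp (k + j) (by omega)).1]
  have hall : ∀ k, o k 2 = 0 := by
    have : ∀ j k, o (k + j) 2 = 0 → o k 2 = 0 := by
      intro j
      induction j with
      | zero => exact fun k h => h
      | succ j ih => exact fun k h => ih k (third_eq_zero_of_image hlam (hstep (k + j)) h)
    exact fun k => this N k (hlarge _ (by omega))
  have hemb : ∀ k, emb ⟨o k 0, o k 1⟩ = o k := by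
    intro k
    ext i
    fin_cases i
    · rfl
    · rfl
    · exact (hall k).symm
  refine ⟨fun k => ⟨o k 0, o k 1⟩, (hemb 0).trans h0, fun k => ?_, ?_⟩
  · rw [Step, hemb, hemb, hstep]
  · simpa only [← norm_emb, hemb] using ht

/-! ### Blowing up neighbourhoods of escaping points -/

lemma isOpen_iterate_img {lam : ℝ} (hlam : 0 < lam) {U : Set ℂ} (hU : IsOpen U) (n : ℕ) :
    IsOpen ((img lam)^[n] U) := by
  induction n with
  | zero => exact hU
  | succ n ih => rw [Function.iterate_succ_apply']; exact isOpen_img hlam ih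

lemma exists_exterior_subset_img {lam : ℝ} (hlam : 0 < lam) {S : Set ℂ} (hS : IsOpen S) {k l : ℤ}
    (hkl : Odd (k + l)) (hc : centre k l ∈ S) : ∃ R : ℝ, ∀ w, R ≤ ‖w‖ → w ∈ img lam S := by
  obtain ⟨δ, hδ, hball⟩ := Metric.isOpen_iff.mp hS _ hc
  refine ⟨lam + 4 * lam / δ, fun w hw => ?_⟩
  have hp : 0 < 4 * lam / δ := by positivity
  have hw0 : 0 < ‖w‖ := by linarith
  refine ⟨branch lam k l w, hball ?_, step_branch hlam (Or.inr ⟨hkl, by linarith⟩)⟩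
  refine (dist_branch_centre_le hlam hkl w).trans_lt ?_
  have h4 : 4 * lam / δ ≤ ‖w‖ := by linarith
  rw [div_le_iff₀ hδ] at h4
  rw [div_lt_iff₀ hw0]
  nlinarith

/-- Iterated images of a neighbourhood of an escaping point contain a neighbourhood of infinity. -/
lemma exists_exterior_subset_iterate_img {lam : ℝ} (hlam : 0 < lam) {o : ℕ → ℂ}
    (hstep : ∀ k, Step lam (o k) (o (k + 1))) (ht : Tendsto (fun k => ‖o k‖) atTop atTop)
    {U : Set ℂ} (hU : IsOpen U) (h0 : o 0 ∈ U) :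
    ∃ (n : ℕ) (R : ℝ), ∀ w, R ≤ ‖w‖ → w ∈ (img lam)^[n] U := by
  -- Beyond r only odd branches are admissible, they contract by 1/2 (16 `lam` ≤ r²), and they land
  -- within distance 1 of their pole (2 `lam` < r).
  set r := 1 + 17 * lam with hr
  have hr0 : 0 < r := by positivity
  obtain ⟨N, hN⟩ := eventually_atTop.mp (ht.eventually_ge_atTop (r + 2))
  have hmem : ∀ k, o k ∈ (img lam)^[k] U := by
    intro k
    induction k with
    | zero => exact h0
    | succ k ih => rw [Function.iterate_succ_apply']; exact ⟨_, ih, hstep k⟩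
  have hbr : ∀ k, N ≤ k → ∃ i j, Odd (i + j) ∧ branch lam i j (o (k + 1)) = o k := by
    intro k hk
    obtain ⟨i, j, hadm, hb⟩ := (hstep k).exists_branch hlam
    refine ⟨i, j, ?_, hb⟩
    rcases hadm with ⟨-, h⟩ | ⟨h, -⟩
    · linarith [hN (k + 1) (by omega)]
    · exact h
  obtain ⟨δ, hδ, hball⟩ := Metric.isOpen_iff.mp (isOpen_iterate_img hlam hU N) _ (hmem N)
  -- Radii double because the branches halve distances. The cap at 1 keeps each disk outside the
  -- circle of radius r.
  have hgrow : ∀ j : ℕ, ball (o (N + j)) (min 1 (2 ^ j * δ)) ⊆ (img lam)^[N + j] U := by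
    intro j
    induction j with
    | zero => exact (ball_subset_ball (by simp)).trans hball
    | succ j ih =>
      intro w hw
      rw [← add_assoc] at hw ⊢
      rw [Function.iterate_succ_apply']
      obtain ⟨i, i', hodd, hb⟩ := hbr (N + j) (by omega)
      rw [mem_ball, lt_min_iff, pow_succ] at hw
      have hno := hN (N + j + 1) (by omega)
      have hnw : r ≤ ‖w‖ := by
        have := norm_sub_norm_le (o (N + j + 1)) w
        rw [← dist_eq_norm, dist_comm] at this
        linarith [hw.1]
      refine ⟨branch lam i i' w, ih ?_, step_branch hlam (Or.inr ⟨hodd, by linarith⟩)⟩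
      have hd := dist_branch_le_of_odd hlam hodd hr0 hnw (show r ≤ ‖o (N + j + 1)‖ by linarith)
      rw [hb] at hd
      have hc : 8 * lam / r ^ 2 ≤ 1 / 2 := by
        rw [div_le_iff₀ (by positivity)]; nlinarith
      have hd' : dist (branch lam i i' w) (o (N + j)) ≤ 1 / 2 * dist w (o (N + j + 1)) :=
        hd.trans (by gcongr)
      rw [mem_ball, lt_min_iff]
      constructor <;> linarith [hw.1, hw.2]
  obtain ⟨j, hj⟩ := pow_unbounded_of_one_lt (1 / δ) one_lt_two
  rw [div_lt_iff₀ hδ] at hj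
  obtain ⟨i, i', hodd, hb⟩ := hbr (N + j) (by omega)
  have hno := hN (N + j + 1) (by omega)
  have hpole : centre i i' ∈ (img lam)^[N + j] U := by
    refine hgrow j ?_
    rw [min_eq_left hj.le, mem_ball, dist_comm, ← hb]
    refine (dist_branch_centre_le hlam hodd _).trans_lt ?_
    rw [div_lt_one (by linarith)]
    linarith
  obtain ⟨R, hR⟩ := exists_exterior_subset_img hlam (isOpen_iterate_img hlam hU _) hodd hpole
  refine ⟨N + j + 1, R, fun w hw => ?_⟩
  rw [Function.iterate_succ_apply']
  exact hR w hw

/-! ### Periodic points from contractions -/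

lemma exists_step (lam : ℝ) (hlam : 0 < lam) (w : ℂ) : ∃ z, Step lam z w := by
  rcases le_total ‖w‖ lam with h | h
  · exact ⟨_, step_branch hlam (k := 0) (l := 0) (Or.inl ⟨by simp, h⟩)⟩
  · exact ⟨_, step_branch hlam (k := 1) (l := 0) (Or.inr ⟨by simp, h⟩)⟩

lemma exists_far_pole {F : Set ℂ} (hF : F.Finite) (R : ℝ) :
    ∃ k : ℤ, Odd (k + 0) ∧ R ≤ ‖centre k 0‖ ∧ centre k 0 ∉ F := by
  have hpi := Real.pi_gt_three
  have hinj : Function.Injective fun m : ℕ => centre (2 * m + 1) 0 := fun m m' h => by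
    have := congrArg Complex.re h
    simp only [centre] at this
    have h2 := mul_right_cancel₀ (by positivity) this
    push_cast at h2
    have : (m : ℝ) = m' := by linarith
    exact_mod_cast this
  obtain ⟨B, hB⟩ := (hF.preimage hinj.injOn).bddAbove
  obtain ⟨m, hm⟩ := exists_nat_ge R
  refine ⟨2 * (m + B + 1 : ℕ) + 1, by simp, ?_, fun h => ?_⟩
  · refine le_trans ?_ (Complex.abs_re_le_norm _)
    refine le_trans ?_ (le_abs_self _)
    simp only [centre]
    push_cast
    have : (0 : ℝ) ≤ m := by positivity
    have : (0 : ℝ) ≤ B := by positivity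
    nlinarith
  · have : m + B + 1 ≤ B := hB h
    omega

/-- If the point `y` has a section over a pole, then periodic points accumulate at `y`. -/
lemma exists_periodic_of_hasSection {lam : ℝ} (hlam : 0 < lam) {n : ℕ} {y : ℂ} {k l : ℤ}
    (hkl : Odd (k + l)) (hy : y ∉ cornerImages lam) (hs : HasSection lam n y (centre k l))
    {ε : ℝ} (hε : 0 < ε) :
    ∃ a ∈ ball y ε, emb a ∈ periodicPoints (scaledT lam) := by
  obtain ⟨g, L, δ, hδ, hgL, hgy, hg⟩ := hs
  -- v is a preimage of y, and s is a local inverse sending y to v.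
  obtain ⟨v, hv⟩ := exists_step lam hlam y
  obtain ⟨s, L', δ', hδ', hsL, hsy, hs⟩ := hv.hasSection hlam hy
  obtain ⟨r, hr, hrmin⟩ := exists_between (lt_min hδ' hε)
  have hrδ : closedBall y r ⊆ ball y δ' :=
    closedBall_subset_ball (hrmin.trans_le (min_le_left _ _))
  have hrε : closedBall y r ⊆ ball y ε := closedBall_subset_ball (hrmin.trans_le (min_le_right _ _))
  have hbound : ∀ a ∈ closedBall y r, ‖s a‖ ≤ ‖v‖ + L' * r := fun a ha => by
    have h1 := hsL.dist_le_mul a (hrδ ha) y (mem_ball_self hδ')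
    rw [hsy, dist_eq_norm] at h1
    have h2 : (L' : ℝ) * dist a y ≤ L' * r := by gcongr; exact ha
    linarith [norm_sub_norm_le (s a) v]
  -- The summands serve, in order: ρ ≤ ρ², admissibility of the odd branch, landing within δ of the
  -- pole, mapping the disk of radius r into itself, and contraction by 1/2.
  set ρ := 1 + lam + 4 * lam / δ + 2 * lam * L / r + 16 * lam * L * L' with hρ
  have p1 : 0 < 4 * lam / δ := by positivity
  have p2 : 0 ≤ 2 * lam * L / r := by positivity
  have p3 : 0 ≤ 16 * lam * L * L' := by positivity
  have hρ1 : 1 ≤ ρ := by linarith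
  have hρ0 : 0 < ρ := by linarith
  obtain ⟨m, hm⟩ := exists_nat_ge (ρ + ‖v‖ + L' * r)
  set t : ℂ → ℂ := fun a => s a + (m * Real.pi : ℝ) with htdef
  have hfar : ∀ a ∈ closedBall y r, ρ ≤ ‖t a‖ := fun a ha => by
    have h1 : ‖((m * Real.pi : ℝ) : ℂ)‖ = m * Real.pi := by
      rw [Complex.norm_real, Real.norm_of_nonneg (by positivity)]
    have h2 : (m : ℝ) ≤ m * Real.pi := le_mul_of_one_le_right (by positivity)
      (by linarith [Real.pi_gt_three])
    have h3 := norm_sub_le (t a) (s a)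
    rw [htdef] at h3
    simp only [add_sub_cancel_left, h1] at h3
    linarith [hbound a ha]
  have hnear : ∀ a ∈ closedBall y r, branch lam k l (t a) ∈ ball (centre k l) δ := fun a ha => by
    refine (dist_branch_centre_le hlam hkl _).trans_lt ?_
    have h1 : 4 * lam / δ ≤ ‖t a‖ := by linarith [hfar a ha]
    rw [div_le_iff₀ hδ] at h1
    rw [div_lt_iff₀ (by linarith [hfar a ha])]
    nlinarith [hfar a ha]
  -- An inverse branch of the (n + 2)-nd iterate: one step for t, one for the odd branch and n for
  -- g.
  set Φ : ℂ → ℂ := fun a => g (branch lam k l (t a)) with hΦ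
  have hmaps : Set.MapsTo Φ (closedBall y r) (closedBall y r) := fun a ha => by
    have h1 := hgL.dist_le_mul _ (hnear a ha) _ (mem_ball_self hδ)
    rw [hgy] at h1
    have h2 := dist_branch_centre_le hlam hkl (t a)
    have h3 : 2 * lam * L / r ≤ ‖t a‖ := by linarith [hfar a ha]
    rw [div_le_iff₀ hr] at h3
    have h4 : 0 < ‖t a‖ := by linarith [hfar a ha]
    calc dist (Φ a) y ≤ L * dist (branch lam k l (t a)) (centre k l) := h1
      _ ≤ L * (2 * lam / ‖t a‖) := by gcongr
      _ = 2 * lam * L / ‖t a‖ := by ring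
      _ ≤ r := by rw [div_le_iff₀ h4]; linarith
  have hlip : ∀ a ∈ closedBall y r, ∀ b ∈ closedBall y r, dist (Φ a) (Φ b) ≤ 1 / 2 * dist a b := by
    intro a ha b hb
    have h1 := hgL.dist_le_mul _ (hnear a ha) _ (hnear b hb)
    have h2 := dist_branch_le_of_odd hlam hkl hρ0 (hfar a ha) (hfar b hb)
    have h3 : dist (t a) (t b) ≤ L' * dist a b := by
      rw [htdef, dist_add_right]
      exact hsL.dist_le_mul a (hrδ ha) b (hrδ hb)
    have h4 : L * (8 * lam / ρ ^ 2 * L') ≤ 1 / 2 := by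
      have : L * (8 * lam / ρ ^ 2 * L') = 8 * lam * L * L' / ρ ^ 2 := by ring
      rw [this, div_le_iff₀ (by positivity)]
      nlinarith
    calc dist (Φ a) (Φ b) ≤ L * (8 * lam / ρ ^ 2 * (L' * dist a b)) := by
          refine h1.trans ?_
          gcongr
          exact h2.trans (by gcongr)
      _ = L * (8 * lam / ρ ^ 2 * L') * dist a b := by ring
      _ ≤ 1 / 2 * dist a b := by gcongr
  have hcontr : ContractingWith (1 / 2) (hmaps.restrict Φ _ _) :=
    ⟨by norm_num, LipschitzWith.of_dist_le_mul fun a b => by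
      have h1 := hlip a a.2 b b.2
      have h2 : ((1 / 2 : ℝ≥0) : ℝ) = 1 / 2 := by norm_num
      rw [h2]
      exact h1⟩
  obtain ⟨a, ha, hfix, -⟩ := hcontr.exists_fixedPoint' isClosed_closedBall.isComplete hmaps
    (mem_closedBall_self hr.le) (edist_ne_top _ _)
  refine ⟨a, hrε ha, n + 1 + 1, by omega, ?_⟩
  have e1 : iter (scaledT lam) n (emb a) = (emb (branch lam k l (t a)) : OnePoint R3) := by
    have := hg _ (hnear a ha)
    rwa [show g (branch lam k l (t a)) = a from hfix] at this
  have e2 : Step lam (branch lam k l (t a)) (t a) :=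
    step_branch hlam (Or.inr ⟨hkl, by linarith [hfar a ha]⟩)
  have e3 : Step lam (t a) a := (iter_one_iff.mp (hs a (hrδ ha))).add_nat_mul_pi hlam m
  exact iter_succ_of_step (iter_succ_of_step e1 e2) e3

end QRTangent

end

open QRTangent in
theorem theorem2p6 (lam : ℝ) (hlam : 0 < lam) :
    QRTangent.escapingSet (QRTangent.scaledT lam) ⊆
      closure (QRTangent.periodicPoints (QRTangent.scaledT lam)) := by
  intro x hx
  obtain ⟨o, rfl, hstep, ht⟩ := exists_planar_orbit hlam hx
  rw [Metric.mem_closure_iff]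
  intro ε hε
  have hU : o 0 ∈ Metric.ball (o 0) (ε / 2) := Metric.mem_ball_self (half_pos hε)
  obtain ⟨n, R, hR⟩ := exists_exterior_subset_iterate_img hlam hstep ht Metric.isOpen_ball hU
  -- Each planar point has at most one finite image, so the corner images have finitely many images
  -- in n steps, while there are infinitely many poles.
  have hF : (⋃ j ∈ Set.Iic n, (img lam)^[j] (cornerImages lam)).Finite := by
    refine (Set.finite_Iic n).biUnion fun j hj => ?_
    clear hj
    induction j with
    | zero => exact finite_cornerImages lam
    | succ j ih => rw [Function.iterate_succ_apply']; exact finite_img ih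
  obtain ⟨k, hk, hfar, hkF⟩ := exists_far_pole hF R
  obtain ⟨y, hy, hyc, hs⟩ := exists_hasSection hlam n (hR _ hfar) fun j hj hmem =>
    hkF (Set.mem_biUnion (Set.mem_Iic.mpr hj) hmem)
  obtain ⟨a, ha, hper⟩ := exists_periodic_of_hasSection hlam hk hyc hs (half_pos hε)
  refine ⟨emb a, hper, ?_⟩
  rw [dist_emb]
  rw [Metric.mem_ball] at hy ha
  linarith [dist_triangle_left (o 0) a y, dist_comm y a]
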